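/- Let $\Phi$ be a unital quantum channel on $n$ qubits, i.e. a completely positive trace preserving linear map on $2^n\times 2^n$ complex matrices with $\Phi(\mathbb I)=\mathbb I$. Its Choi state is $\tau=(\Phi\otimes\mathrm{id})(|\Omega\rangle\langle\Omega|)$, where $|\Omega\rangle=2^{-n/2}\sum_i|i\,i\rangle$, and $S(\tau)=-\operatorname{Tr}[\tau\log_2\tau]$ is its von Neumann entropy. For unitaries $U_1,\dots,U_D\in U(2^n)$, with $\mathcal U_i(X)=U_iXU_i^\dagger$, consider the noisy circuit $$\mathcal E=\Phi\circ\mathcal U_D\circ\Phi\circ\cdots\circ\Phi\circ\mathcal U_2\circ\Phi\circ\mathcal U_1 .$$ A unitary 1-design is a probability measure on $U(2^n)$ under which every polynomial that is homogeneous of degree $1$ in the entries of $U$ and homogeneous of degree $1$ in their complex conjugates has the same expectation as under the Haar measure. A state 1-design is the law of $U|\phi_0\rangle$, with $|\phi_0\rangle$ a fixed unit vector and $U$ distributed according to a unitary 1-design. Let $|\psi\rangle,|\phi\rangle,U_1,\dots,U_D$ be independent, where $|\psi\rangle$ and $|\phi\rangle$ are each distributed according to a (possibly different) state 1-design and every $U_i$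 according to a (possibly different) unitary 1-design. With $\|\cdot\|_1$ the trace norm (the sum of the singular values), put $$\bar\eta=\mathbb E_{\psi,\phi,U_1,\dots,U_D}\left[\frac{\big\|\mathcal E(|\psi\rangle\langle\psi|)-\mathcal E(|\phi\rangle\langle\phi|)\big\|_1}{\big\||\psi\rangle\langle\psi|-|\phi\rangle\langle\phi|\big\|_1}\right],$$ where the ratio is set to $0$, its least possible value, when $|\psi\rangle\langle\psi|=|\phi\rangle\langle\phi|$. **(1)** For all $\varepsilon\in(0,1)$, $\delta>0$ and $K\in\mathbb N$ there is a $D_0$, depending only on $\varepsilon$, $\delta$ and $K$ (in particular not on $n$), such that for every $n$, every unital $n$-qubit channel $\Phi$ whose Choi state has rank at most $K$ (equivalently, which has a Kraus decomposition with at most $K$ operators), every $D\ge D_0$ and all 1-designs as above, $$\bar\eta\;\ge\;1-\varepsilon-2^{D(S(\tau)+\delta)-n}.$$ **(2)** Let $\varphi$ be a unital single-qubit channel with Choi state $\tau_1$, and let the depth $D$ be fixed with $D\,S(\tau_1)<1$ (that is, $D<1/S(\tau_1)$, with no restriction on $D$ if $S(\tau_1)=0$). For every $n$ let $\Phi=\varphi^{\otimes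 n}$, and choose arbitrary state and unitary 1-designs on $n$ qubits as above. Then $\bar\eta\to1$ as $n\to\infty$. -/

import Mathlib

open MeasureTheory Filter Topology Matrix
open scoped ComplexOrder

noncomputable section

/-- Labels of the computational basis of `n` qubits, so that `n`-qubit operators are
matrices of size `2 ^ n`. -/
abbrev Qubits (n : ℕ) : Type := Fin n → Fin 2

/-! ### Trace norm, channels, Choi state, entropy -/

/-- The trace norm (Schatten `1`-norm): the sum of the singular values, with multiplicity. -/
def traceNorm {ι : Type} [Fintype ι] [DecidableEq ι] (A : Matrix ι ι ℂ) : ℝ :=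
  ∑ k ∈ Finset.range (Fintype.card ι), (Matrix.toEuclideanLin A).singularValues k

/-- `T ⊗ id` on operators of a bipartite system: `T` is applied to each block
`(⟨i, a| M |j, b⟩)_{i, j}`. -/
def tensorId {ι : Type} (T : Matrix ι ι ℂ →ₗ[ℂ] Matrix ι ι ℂ) {κ : Type}
    (M : Matrix (ι × κ) (ι × κ) ℂ) : Matrix (ι × κ) (ι × κ) ℂ :=
  Matrix.of fun p q => T (Matrix.of fun i j => M (i, p.2) (j, q.2)) p.1 q.1

/-- Complete positivity: `T ⊗ id` is positive for every finite-dimensional ancilla. -/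
def IsCompletelyPositive {ι : Type} (T : Matrix ι ι ℂ →ₗ[ℂ] Matrix ι ι ℂ) : Prop :=
  ∀ (κ : Type) [Fintype κ] (M : Matrix (ι × κ) (ι × κ) ℂ),
    M.PosSemidef → (tensorId T M).PosSemidef

/-- A quantum channel: a completely positive and trace preserving linear map. -/
structure IsQuantumChannel {ι : Type} [Fintype ι] (T : Matrix ι ι ℂ →ₗ[ℂ] Matrix ι ι ℂ) :
    Prop where
  completelyPositive : IsCompletelyPositive T
  tracePreserving : ∀ A, (T A).trace = A.trace

/-- The channel fixes the identity. -/
def IsUnital {ι : Type} [DecidableEq ι] (T : Matrix ι ι ℂ →ₗ[ℂ] Matrix ι ι ℂ) : Prop :=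
  T 1 = 1

/-- The maximally entangled unit vector `d^{-1/2} ∑ i, |i i⟩`. -/
def maxEntangled (ι : Type) [Fintype ι] [DecidableEq ι] : ι × ι → ℂ :=
  fun p => if p.1 = p.2 then ((√(Fintype.card ι : ℝ) : ℝ) : ℂ)⁻¹ else 0

/-- The Choi state `(T ⊗ id)(|Ω⟩⟨Ω|)`. -/
def choiState {ι : Type} [Fintype ι] [DecidableEq ι] (T : Matrix ι ι ℂ →ₗ[ℂ] Matrix ι ι ℂ) :
    Matrix (ι × ι) (ι × ι) ℂ :=
  tensorId T (Matrix.vecMulVec (maxEntangled ι) (star (maxEntangled ι)))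

open Classical in
/-- The von Neumann entropy in bits, `S(ρ) = -∑ λ log₂ λ` over the eigenvalues of the
Hermitian matrix `ρ` (with `0 log 0 = 0`; the value at non-Hermitian matrices is irrelevant). -/
def vonNeumannEntropy {κ : Type} [Fintype κ] [DecidableEq κ] (ρ : Matrix κ κ ℂ) : ℝ :=
  if h : ρ.IsHermitian then -∑ i, h.eigenvalues i * Real.logb 2 (h.eigenvalues i) else 0

/-- The product channel `φ^{⊗ n}` of a single-qubit map `φ`: the linear map with
`|i₁…iₙ⟩⟨j₁…jₙ| ↦ ⨂ₛ φ(|iₛ⟩⟨jₛ|)`. -/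
def tensorPower (φ : Matrix (Fin 2) (Fin 2) ℂ →ₗ[ℂ] Matrix (Fin 2) (Fin 2) ℂ) (n : ℕ) :
    Matrix (Qubits n) (Qubits n) ℂ →ₗ[ℂ] Matrix (Qubits n) (Qubits n) ℂ where
  toFun M := Matrix.of fun a b =>
    ∑ i, ∑ j, M i j * ∏ s, φ (Matrix.single (i s) (j s) 1) (a s) (b s)
  map_add' M N := by
    ext a b
    simp [add_mul, Finset.sum_add_distrib]
  map_smul' c M := by
    ext a b
    simp [Finset.mul_sum, mul_assoc]

/-! ### Designs -/

instance {ι : Type} [Fintype ι] [DecidableEq ι] : MeasurableSpace (Matrix.unitaryGroup ι ℂ) :=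
  borel _

instance {ι : Type} [Fintype ι] [DecidableEq ι] : BorelSpace (Matrix.unitaryGroup ι ℂ) :=
  ⟨rfl⟩

instance {ι : Type} [Fintype ι] [DecidableEq ι] : CompactSpace (Matrix.unitaryGroup ι ℂ) := by
  refine isCompact_iff_compactSpace.mp ?_
  have hK : IsCompact (Set.univ.pi fun _ : ι => Set.univ.pi fun _ : ι =>
      Metric.closedBall (0 : ℂ) 1) :=
    isCompact_univ_pi fun _ => isCompact_univ_pi fun _ => isCompact_closedBall 0 1
  refine hK.of_isClosed_subset ?_ ?_
  · exact isClosed_unitary (R := Matrix ι ι ℂ)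
  · intro U hU i _ j _
    simpa using entry_norm_bound_of_unitary hU i j

/-- The normalized Haar measure on the unitary group. -/
def haarUnitary (ι : Type) [Fintype ι] [DecidableEq ι] : Measure (Matrix.unitaryGroup ι ℂ) :=
  Measure.haarMeasure ⊤

/-- The value at `U` of a polynomial in the entries of `U` (the variables `Sum.inl (i, j)`) and
in their complex conjugates (the variables `Sum.inr (i, j)`). -/
def evalUnitary {ι : Type} [Fintype ι] [DecidableEq ι]
    (p : MvPolynomial ((ι × ι) ⊕ (ι × ι)) ℂ) (U : Matrix.unitaryGroup ι ℂ) : ℂ :=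
  MvPolynomial.eval
    (Sum.elim (fun e => (U : Matrix ι ι ℂ) e.1 e.2) (fun e => star ((U : Matrix ι ι ℂ) e.1 e.2))) p

/-- `p` is homogeneous of degree `t` in the entries of `U` and homogeneous of degree `t` in
their conjugates. -/
def IsBihomogeneous {ι : Type} (t : ℕ) (p : MvPolynomial ((ι × ι) ⊕ (ι × ι)) ℂ) : Prop :=
  MvPolynomial.IsWeightedHomogeneous
    (Sum.elim (fun _ => ((1, 0) : ℕ × ℕ)) (fun _ => ((0, 1) : ℕ × ℕ))) p (t, t)

/-- A unitary `t`-design: a probability measure on the unitary group whose averages of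
polynomials of bidegree `(t, t)` are those of the Haar measure. -/
structure IsUnitaryDesign {ι : Type} [Fintype ι] [DecidableEq ι] (t : ℕ)
    (μ : Measure (Matrix.unitaryGroup ι ℂ)) : Prop where
  isProbabilityMeasure : IsProbabilityMeasure μ
  integral_eq : ∀ p : MvPolynomial ((ι × ι) ⊕ (ι × ι)) ℂ, IsBihomogeneous t p →
    ∫ U, evalUnitary p U ∂μ = ∫ U, evalUnitary p U ∂(haarUnitary ι)

/-- A state `t`-design: the law of `U |φ₀⟩` for a fixed unit vector `φ₀` and a unitary
`U` distributed according to a unitary `t`-design. -/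
def IsStateDesign {ι : Type} [Fintype ι] [DecidableEq ι] (t : ℕ)
    (ν : Measure (EuclideanSpace ℂ ι)) : Prop :=
  ∃ (φ₀ : EuclideanSpace ℂ ι) (μ : Measure (Matrix.unitaryGroup ι ℂ)),
    ‖φ₀‖ = 1 ∧ IsUnitaryDesign t μ ∧
      ν = μ.map fun U : Matrix.unitaryGroup ι ℂ =>
        Matrix.toEuclideanLin (U : Matrix ι ι ℂ) φ₀

/-! ### Noisy circuits and their average contraction -/

/-- The pure state `|ψ⟩⟨ψ|`. -/
def pureState {ι : Type} (ψ : EuclideanSpace ℂ ι) : Matrix ι ι ℂ :=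
  Matrix.of fun i j => ψ i * star (ψ j)

/-- Conjugation `A ↦ U A U†`. -/
def unitaryConj {ι : Type} [Fintype ι] [DecidableEq ι] (U : Matrix.unitaryGroup ι ℂ) :
    Matrix ι ι ℂ →ₗ[ℂ] Matrix ι ι ℂ where
  toFun A := (U : Matrix ι ι ℂ) * A * (U : Matrix ι ι ℂ)ᴴ
  map_add' A B := by simp [mul_add, add_mul]
  map_smul' c A := by simp

/-- The noisy circuit `Φ ∘ 𝒰_D ∘ ⋯ ∘ Φ ∘ 𝒰_2 ∘ Φ ∘ 𝒰_1`; the layer `𝒰_{k+1}` is conjugation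
by `U k`. -/
def noisyCircuit {ι : Type} [Fintype ι] [DecidableEq ι]
    (Φ : Matrix ι ι ℂ →ₗ[ℂ] Matrix ι ι ℂ) :
    (D : ℕ) → (Fin D → Matrix.unitaryGroup ι ℂ) → (Matrix ι ι ℂ →ₗ[ℂ] Matrix ι ι ℂ)
  | 0, _ => LinearMap.id
  | D + 1, U => Φ ∘ₗ unitaryConj (U (Fin.last D)) ∘ₗ noisyCircuit Φ D fun k => U k.castSucc

/-- The ratio `‖T(ψ) - T(φ)‖₁ / ‖ψ - φ‖₁` of trace distances for pure inputs. When the two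
states coincide it is `0`, the smallest value that could be assigned to the ratio. -/
def contractionRatio {ι : Type} [Fintype ι] [DecidableEq ι]
    (T : Matrix ι ι ℂ →ₗ[ℂ] Matrix ι ι ℂ) (ψ φ : EuclideanSpace ℂ ι) : ℝ :=
  traceNorm (T (pureState ψ) - T (pureState φ)) / traceNorm (pureState ψ - pureState φ)

/-- The expected ratio of trace distances of a noisy circuit of depth `D`, where the two inputs,
with laws `ν₁` and `ν₂`, and the layers, with laws `μ k`, are all independent. -/
def averageContraction {ι : Type} [Fintype ι] [DecidableEq ι]
    (Φ : Matrix ι ι ℂ →ₗ[ℂ] Matrix ι ι ℂ) (D : ℕ) (ν₁ ν₂ : Measure (EuclideanSpace ℂ ι))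
    (μ : Fin D → Measure (Matrix.unitaryGroup ι ℂ)) : ℝ :=
  ∫ ω : EuclideanSpace ℂ ι × EuclideanSpace ℂ ι × (Fin D → Matrix.unitaryGroup ι ℂ),
    contractionRatio (noisyCircuit Φ D ω.2.2) ω.1 ω.2.1 ∂(ν₁.prod (ν₂.prod (Measure.pi μ)))

end

/-!
The eigenvectors of the Choi state of `Φ`, read as matrices, form a Kraus decomposition of `Φ`
whose weights are the eigenvalues. A circuit of depth `D` is then a sum over Kraus paths, and
averaging over the 1-designs turns the weights of the paths into the `D`-fold product of this
distribution. By Chebyshev's inequality, a set `G` of at most `2 ^ (D S + t)` paths carries a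
fraction at least `1 - D V / t ^ 2` of the weight, where `V` is the variance of the surprisal of
the Choi spectrum. Let `P` be the projection onto the span of the outputs of `ψ` along the paths in
`G`. It accepts `E(ψ)` with average probability at least the weight of `G`. Its rank is at most
`|G|` and `E` is unital, so it accepts `E(φ)` with average probability at most `|G| / d`, where `d`
is the dimension. The distance of two states is at least twice the bias of any test between them,
and that of two pure states is at most `2`, so the expected ratio is at least the difference of the
two probabilities.
-/

section TraceNorm

variable {ι : Type} [Fintype ι] [DecidableEq ι] {A B : Matrix ι ι ℂ}

lemma continuousOn_spectrum (f : ℝ → ℝ) (A : Matrix ι ι ℂ) : ContinuousOn f (spectrum ℝ A) :=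
  A.finite_real_spectrum.continuousOn f

lemma trace_mul_cfc (hA : A.IsHermitian) (W : Matrix ι ι ℂ) (f : ℝ → ℝ) :
    (W * cfc f A).trace =
      ∑ i, ((hA.eigenvectorUnitary : Matrix ι ι ℂ)ᴴ * W * hA.eigenvectorUnitary) i i *
        (f (hA.eigenvalues i) : ℂ) := by
  rw [hA.cfc_eq, IsHermitian.cfc, Unitary.conjStarAlgAut_apply, ← Matrix.mul_assoc,
    trace_mul_comm, ← Matrix.mul_assoc, ← Matrix.mul_assoc]
  simp [trace, mul_diagonal, star_eq_conjTranspose]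

lemma trace_cfc (hA : A.IsHermitian) (f : ℝ → ℝ) :
    (cfc f A).trace = ∑ i, (f (hA.eigenvalues i) : ℂ) := by
  simpa [← star_eq_conjTranspose] using trace_mul_cfc hA 1 f

lemma posSemidef_cfc (hA : A.IsHermitian) {f : ℝ → ℝ} (hf : 0 ≤ f) : (cfc f A).PosSemidef := by
  rw [hA.cfc_eq, IsHermitian.cfc, Unitary.conjStarAlgAut_apply]
  exact (PosSemidef.diagonal fun i => by simpa using hf _).mul_mul_conjTranspose_same _

lemma traceNorm_eq_sum_sqrt_eigenvalues (hA : (Aᴴ * A).IsHermitian) :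
    traceNorm A = ∑ i, √(hA.eigenvalues i) := by
  have hadj : LinearMap.adjoint (toEuclideanLin A) ∘ₗ toEuclideanLin A =
      toEuclideanLin (Aᴴ * A) := by
    rw [← toEuclideanLin_conjTranspose_eq_adjoint]
    ext v : 1
    simp [toLpLin_apply, mulVec_mulVec]
  have hsum : traceNorm A = ∑ i : Fin (Fintype.card ι), √(hA.eigenvalues₀ i) := by
    rw [traceNorm, Finset.sum_range]
    refine Finset.sum_congr rfl fun i _ => ?_
    rw [LinearMap.singularValues_fin (toEuclideanLin A) finrank_euclideanSpace i]
    unfold IsHermitian.eigenvalues₀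
    simp only [hadj]
  rw [hsum]
  exact (Equiv.sum_comp (Fintype.equivOfCardEq (Fintype.card_fin _)).symm
    fun i => √(hA.eigenvalues₀ i)).symm

lemma traceNorm_eq_sum_abs_eigenvalues (hA : A.IsHermitian) :
    traceNorm A = ∑ i, |hA.eigenvalues i| := by
  have hsq := isHermitian_conjTranspose_mul_self A
  have hcfc : Aᴴ * A = cfc (fun x : ℝ => x ^ 2) A := by
    rw [cfc_pow_id A 2 hA.isSelfAdjoint, hA.eq, sq]
  have hroots : Finset.univ.val.map (fun i => (hsq.eigenvalues i : ℂ)) =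
      Finset.univ.val.map fun i => ((hA.eigenvalues i ^ 2 : ℝ) : ℂ) := by
    rw [← Polynomial.roots_multiset_prod_X_sub_C
      (Finset.univ.val.map fun i => ((hA.eigenvalues i ^ 2 : ℝ) : ℂ)), Multiset.map_map]
    exact hsq.roots_charpoly_eq_eigenvalues.symm.trans
      (congrArg Polynomial.roots ((congrArg charpoly hcfc).trans (hA.charpoly_cfc_eq _)))
  rw [traceNorm_eq_sum_sqrt_eigenvalues hsq]
  simpa [Real.sqrt_sq_eq_abs, -Complex.ofReal_pow] using
    congrArg (fun s => (s.map fun z : ℂ => √z.re).sum) hroots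

lemma traceNorm_nonneg (A : Matrix ι ι ℂ) : 0 ≤ traceNorm A :=
  Finset.sum_nonneg fun _ _ => LinearMap.singularValues_nonneg _ _

lemma traceNorm_eq_re_trace (hA : A.PosSemidef) : traceNorm A = A.trace.re := by
  rw [traceNorm_eq_sum_abs_eigenvalues hA.1, hA.1.trace_eq_sum_eigenvalues, Complex.re_sum]
  exact Finset.sum_congr rfl fun i _ => by simp [abs_of_nonneg (hA.eigenvalues_nonneg i)]

lemma re_trace_unitary_mul_le_traceNorm (hA : A.IsHermitian) {W : Matrix ι ι ℂ}
    (hW : W ∈ unitaryGroup ι ℂ) : (W * A).trace.re ≤ traceNorm A := by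
  have hconj : (hA.eigenvectorUnitary : Matrix ι ι ℂ)ᴴ * W * hA.eigenvectorUnitary ∈
      unitaryGroup ι ℂ :=
    mul_mem (mul_mem (star hA.eigenvectorUnitary).2 hW) hA.eigenvectorUnitary.2
  have htrace := trace_mul_cfc hA W id
  rw [cfc_id ℝ A hA.isSelfAdjoint] at htrace
  rw [traceNorm_eq_sum_abs_eigenvalues hA, htrace, Complex.re_sum]
  refine Finset.sum_le_sum fun i _ => (Complex.re_le_norm _).trans ?_
  rw [norm_mul, Complex.norm_real, Real.norm_eq_abs]
  exact mul_le_of_le_one_left (abs_nonneg _) (entry_norm_bound_of_unitary hconj i i)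

lemma exists_unitary_re_trace_mul_eq_traceNorm (hA : A.IsHermitian) :
    ∃ W ∈ unitaryGroup ι ℂ, (W * A).trace.re = traceNorm A := by
  let sgn : ℝ → ℝ := fun x => if 0 ≤ x then 1 else -1
  have hsgn_sq (x : ℝ) : sgn x * sgn x = 1 := by simp only [sgn]; split_ifs <;> norm_num
  have hsgn_mul (x : ℝ) : sgn x * x = |x| := by
    simp only [sgn]
    split_ifs with h
    · rw [one_mul, abs_of_nonneg h]
    · rw [neg_one_mul, abs_of_neg (not_le.mp h)]
  refine ⟨cfc sgn A, ?_, ?_⟩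
  · rw [mem_unitaryGroup_iff, (cfc_predicate sgn A).star_eq,
      ← cfc_mul _ _ A (continuousOn_spectrum _ A) (continuousOn_spectrum _ A)]
    simp only [hsgn_sq, cfc_const_one ℝ A hA.isSelfAdjoint]
  · have habs : cfc sgn A * A = cfc (fun x : ℝ => |x|) A := by
      nth_rw 2 [← cfc_id' ℝ A hA.isSelfAdjoint]
      rw [← cfc_mul _ _ A (continuousOn_spectrum _ A) (continuousOn_spectrum _ A)]
      simp only [hsgn_mul]
    rw [habs, trace_cfc hA, traceNorm_eq_sum_abs_eigenvalues hA]
    simp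

lemma traceNorm_sub_le_re_trace_add (hA : A.PosSemidef) (hB : B.PosSemidef) :
    traceNorm (A - B) ≤ A.trace.re + B.trace.re := by
  obtain ⟨W, hW, hWtrace⟩ := exists_unitary_re_trace_mul_eq_traceNorm (hA.1.sub hB.1)
  have hWA := re_trace_unitary_mul_le_traceNorm hA.1 hW
  have hWB := re_trace_unitary_mul_le_traceNorm hB.1 (W := -W)
    (by simpa [mem_unitaryGroup_iff] using hW)
  rw [traceNorm_eq_re_trace hA] at hWA
  rw [traceNorm_eq_re_trace hB, Matrix.neg_mul, trace_neg, Complex.neg_re] at hWB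
  rw [← hWtrace, Matrix.mul_sub, trace_sub, Complex.sub_re]
  linarith

lemma exists_posSemidef_sub_eq (hA : A.IsHermitian) :
    ∃ P N : Matrix ι ι ℂ, P.PosSemidef ∧ N.PosSemidef ∧ P - N = A ∧
      P.trace.re + N.trace.re = traceNorm A := by
  refine ⟨cfc (fun x : ℝ => x⁺) A, cfc (fun x : ℝ => x⁻) A,
    posSemidef_cfc hA fun x => posPart_nonneg x, posSemidef_cfc hA fun x => negPart_nonneg x,
    ?_, ?_⟩
  · rw [← cfc_sub _ _ A (continuousOn_spectrum _ A) (continuousOn_spectrum _ A)]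
    simp only [posPart_sub_negPart, cfc_id' ℝ A hA.isSelfAdjoint]
  · rw [trace_cfc hA, trace_cfc hA, traceNorm_eq_sum_abs_eigenvalues hA, ← Complex.add_re,
      ← Finset.sum_add_distrib, Complex.re_sum]
    exact Finset.sum_congr rfl fun i _ => by
      rw [← Complex.ofReal_add, posPart_add_negPart, Complex.ofReal_re]

/-- A positive trace preserving linear map on matrices: the part of the definition of a quantum
channel that is needed for it to be a contraction in trace norm. -/
structure IsPositiveTracePreserving (T : Matrix ι ι ℂ →ₗ[ℂ] Matrix ι ι ℂ) : Prop where
  posSemidef : ∀ ⦃A : Matrix ι ι ℂ⦄, A.PosSemidef → (T A).PosSemidef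
  trace_map : ∀ A, (T A).trace = A.trace

omit [DecidableEq ι] in
lemma IsPositiveTracePreserving.comp {S T : Matrix ι ι ℂ →ₗ[ℂ] Matrix ι ι ℂ}
    (hS : IsPositiveTracePreserving S) (hT : IsPositiveTracePreserving T) :
    IsPositiveTracePreserving (S ∘ₗ T) :=
  ⟨fun _ hA => hS.posSemidef (hT.posSemidef hA), fun _ => (hS.trace_map _).trans (hT.trace_map _)⟩

lemma IsPositiveTracePreserving.traceNorm_map_le {T : Matrix ι ι ℂ →ₗ[ℂ] Matrix ι ι ℂ}
    (hT : IsPositiveTracePreserving T) (hA : A.IsHermitian) : traceNorm (T A) ≤ traceNorm A := by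
  obtain ⟨P, N, hP, hN, rfl, htrace⟩ := exists_posSemidef_sub_eq hA
  rw [map_sub, ← htrace, ← hT.trace_map P, ← hT.trace_map N]
  exact traceNorm_sub_le_re_trace_add (hT.posSemidef hP) (hT.posSemidef hN)

lemma two_mul_re_trace_mul_le_traceNorm {P : Matrix ι ι ℂ} (hP : IsStarProjection P)
    (hA : A.IsHermitian) (htrace : A.trace = 0) : 2 * (P * A).trace.re ≤ traceNorm A := by
  have hW := re_trace_unitary_mul_le_traceNorm hA hP.two_mul_sub_one_mem_unitary
  rw [Matrix.sub_mul, two_mul, Matrix.add_mul, Matrix.one_mul, trace_sub, trace_add, htrace,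
    sub_zero, Complex.add_re] at hW
  linarith

lemma measurable_traceNorm {X : Type*} [TopologicalSpace X] [MeasurableSpace X]
    [OpensMeasurableSpace X] {f : X → Matrix ι ι ℂ} (hf : Continuous f)
    (hH : ∀ x, (f x).IsHermitian) : Measurable fun x => traceNorm (f x) := by
  refine LowerSemicontinuous.measurable fun x c hc => ?_
  obtain ⟨W, hW, hWtrace⟩ := exists_unitary_re_trace_mul_eq_traceNorm (hH x)
  have hcont : Continuous fun y => (W * f y).trace.re :=
    Complex.continuous_re.comp (continuous_const.matrix_mul hf).matrix_trace
  filter_upwards [hcont.continuousAt.eventually_const_lt (hc.trans_eq hWtrace.symm)] with y hy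
  exact hy.trans_le (re_trace_unitary_mul_le_traceNorm (hH y) hW)

end TraceNorm

section SpanProjection

variable {ι : Type} [Fintype ι] [DecidableEq ι]

/-- The matrix of the orthogonal projection onto a subspace of the Euclidean space. -/
noncomputable def projectionMatrix (S : Submodule ℂ (EuclideanSpace ℂ ι)) : Matrix ι ι ℂ :=
  (toEuclideanCLM (n := ι) (𝕜 := ℂ)).symm S.starProjection

variable (S : Submodule ℂ (EuclideanSpace ℂ ι))

lemma toEuclideanCLM_projectionMatrix :
    toEuclideanCLM (n := ι) (𝕜 := ℂ) (projectionMatrix S) = S.starProjection :=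
  StarAlgEquiv.apply_symm_apply _ _

lemma isStarProjection_projectionMatrix : IsStarProjection (projectionMatrix S) := by
  have hS : IsStarProjection S.starProjection := isStarProjection_starProjection
  constructor
  · rw [IsIdempotentElem, projectionMatrix, ← map_mul, hS.isIdempotentElem.eq]
  · apply EquivLike.injective (toEuclideanCLM (n := ι) (𝕜 := ℂ))
    rw [map_star, toEuclideanCLM_projectionMatrix, hS.isSelfAdjoint.star_eq]

lemma projectionMatrix_mulVec_of_mem {v : EuclideanSpace ℂ ι} (hv : v ∈ S) :
    projectionMatrix S *ᵥ v.ofLp = v.ofLp := by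
  rw [← ofLp_toEuclideanCLM, toEuclideanCLM_projectionMatrix,
    Submodule.starProjection_eq_self_iff.mpr hv]

lemma trace_projectionMatrix : (projectionMatrix S).trace = Module.finrank ℂ S := by
  have hproj : LinearMap.IsProj S (toEuclideanLin (projectionMatrix S)) := by
    rw [← coe_toEuclideanCLM_eq_toEuclideanLin, toEuclideanCLM_projectionMatrix]
    exact ⟨S.starProjection_apply_mem, fun v hv => Submodule.starProjection_eq_self_iff.mpr hv⟩
  rw [← hproj.trace]
  exact (trace_toLin_eq _ (PiLp.basisFun 2 ℂ ι)).symm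

omit [DecidableEq ι] in
lemma exists_isStarProjection_of_finset {B : Type*} (G : Finset B) (v : B → ι → ℂ) :
    ∃ P : Matrix ι ι ℂ, IsStarProjection P ∧ (∀ b ∈ G, P *ᵥ v b = v b) ∧ P.trace.re ≤ G.card := by
  classical
  let W : Finset (EuclideanSpace ℂ ι) := G.image fun b => WithLp.toLp 2 (v b)
  let S := Submodule.span ℂ (W : Set (EuclideanSpace ℂ ι))
  refine ⟨projectionMatrix S, isStarProjection_projectionMatrix S, fun b hb =>
    projectionMatrix_mulVec_of_mem S (v := WithLp.toLp 2 (v b))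
      (Submodule.subset_span (Finset.mem_image_of_mem _ hb)), ?_⟩
  rw [trace_projectionMatrix, Complex.natCast_re]
  exact_mod_cast (finrank_span_finset_le_card W).trans Finset.card_image_le

end SpanProjection

section Typicality

variable {A : Type*} [Fintype A]

/-- The Shannon entropy in bits of a weight function. -/
noncomputable def shannonEntropy (p : A → ℝ) : ℝ := -∑ a, p a * Real.logb 2 (p a)

/-- The variance of the surprisal `-log₂ p`. -/
noncomputable def varentropy (p : A → ℝ) : ℝ :=
  ∑ a, p a * (-Real.logb 2 (p a) - shannonEntropy p) ^ 2

lemma sum_mul_surprisal_sub_entropy {p : A → ℝ} (hs : ∑ a, p a = 1) :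
    ∑ a, p a * (-Real.logb 2 (p a) - shannonEntropy p) = 0 := by
  simp only [mul_sub, Finset.sum_sub_distrib, ← Finset.sum_mul, hs, mul_neg,
    Finset.sum_neg_distrib, one_mul, shannonEntropy, sub_self]

lemma varentropy_le_sum_mul_logb_sq {p : A → ℝ} (hs : ∑ a, p a = 1) :
    varentropy p ≤ ∑ a, p a * Real.logb 2 (p a) ^ 2 := by
  have hexpand : ∀ a, p a * (-Real.logb 2 (p a) - shannonEntropy p) ^ 2 =
      p a * Real.logb 2 (p a) ^ 2 + 2 * shannonEntropy p * (p a * Real.logb 2 (p a)) +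
        p a * shannonEntropy p ^ 2 := fun a => by ring
  have hvar : varentropy p = ∑ a, p a * Real.logb 2 (p a) ^ 2 - shannonEntropy p ^ 2 := by
    have hentropy : ∑ a, p a * Real.logb 2 (p a) = -shannonEntropy p := (neg_neg _).symm
    simp only [varentropy, hexpand, Finset.sum_add_distrib, ← Finset.mul_sum, ← Finset.sum_mul,
      hs, hentropy]
    ring
  exact hvar.trans_le (sub_le_self _ (sq_nonneg _))

lemma mul_logb_sq_le {x : ℝ} (h0 : 0 ≤ x) (h1 : x ≤ 1) :
    x * Real.logb 2 x ^ 2 ≤ 4 / Real.log 2 ^ 2 := by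
  rcases h0.eq_or_lt with rfl | h0
  · rw [zero_mul]; positivity
  have hsqrt : (Real.log (√x) * √x) ^ 2 ≤ 1 := by
    rw [← sq_abs]
    exact pow_le_one₀ (abs_nonneg _)
      (Real.abs_log_mul_self_lt (√x) (Real.sqrt_pos.mpr h0) (Real.sqrt_le_one.mpr h1)).le
  rw [mul_pow, Real.sq_sqrt h0.le, Real.log_sqrt h0.le] at hsqrt
  rw [Real.logb, div_pow, ← mul_div_assoc]
  gcongr
  linarith

lemma varentropy_le_card_support_mul {p : A → ℝ} (hp : p ∈ stdSimplex ℝ A) :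
    varentropy p ≤ Fintype.card {a // p a ≠ 0} * (4 / Real.log 2 ^ 2) := by
  classical
  have hle : ∀ a, p a ≤ 1 := fun a =>
    (Finset.single_le_sum (fun a _ => hp.1 a) (Finset.mem_univ a)).trans_eq hp.2
  calc varentropy p
      ≤ ∑ a, p a * Real.logb 2 (p a) ^ 2 := varentropy_le_sum_mul_logb_sq hp.2
    _ = ∑ a with p a ≠ 0, p a * Real.logb 2 (p a) ^ 2 :=
        (Finset.sum_filter_of_ne fun a _ h => left_ne_zero_of_mul h).symm
    _ ≤ (Finset.univ.filter fun a => p a ≠ 0).card • (4 / Real.log 2 ^ 2) :=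
        Finset.sum_le_card_nsmul _ _ _ fun a _ => mul_logb_sq_le (hp.1 a) (hle a)
    _ = Fintype.card {a // p a ≠ 0} * (4 / Real.log 2 ^ 2) := by
        rw [nsmul_eq_mul, Fintype.card_subtype]

open Classical in
/-- The elements whose surprisal `-log₂ p` exceeds the entropy by at most `t`. -/
noncomputable def typicalSet (p : A → ℝ) (t : ℝ) : Finset A :=
  {a | (2 : ℝ) ^ (-(shannonEntropy p + t)) ≤ p a}

lemma card_typicalSet_le {p : A → ℝ} (hp : p ∈ stdSimplex ℝ A) (t : ℝ) :
    ((typicalSet p t).card : ℝ) ≤ 2 ^ (shannonEntropy p + t) := by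
  have hmass : ((typicalSet p t).card : ℝ) * 2 ^ (-(shannonEntropy p + t)) ≤ 1 := by
    rw [← hp.2, ← nsmul_eq_mul, ← Finset.sum_const]
    exact (Finset.sum_le_sum fun a ha => (Finset.mem_filter.mp ha).2).trans
      (Finset.sum_le_univ_sum_of_nonneg hp.1)
  rwa [Real.rpow_neg zero_le_two, ← div_eq_mul_inv, div_le_one (by positivity)] at hmass

lemma lt_surprisal_sub_entropy_of_notMem_typicalSet {p : A → ℝ} {t : ℝ} {a : A} (ha : 0 < p a)
    (hmem : a ∉ typicalSet p t) : t < -Real.logb 2 (p a) - shannonEntropy p := by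
  have hlt : p a < 2 ^ (-(shannonEntropy p + t)) := by simpa [typicalSet] using hmem
  linarith [(Real.logb_lt_iff_lt_rpow one_lt_two ha).mpr hlt]

lemma one_sub_varentropy_div_le_sum_typicalSet {p : A → ℝ} (hp : p ∈ stdSimplex ℝ A) {t : ℝ}
    (ht : 0 < t) : 1 - varentropy p / t ^ 2 ≤ ∑ a ∈ typicalSet p t, p a := by
  classical
  set g : A → ℝ := fun a => -Real.logb 2 (p a) - shannonEntropy p
  have hcheb : ∀ a ∈ (typicalSet p t)ᶜ, p a ≤ p a * g a ^ 2 / t ^ 2 := by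
    intro a ha
    rcases (hp.1 a).eq_or_lt with h0 | h0
    · simp [← h0]
    have hlt : t < g a :=
      lt_surprisal_sub_entropy_of_notMem_typicalSet h0 (Finset.mem_compl.mp ha)
    rw [le_div_iff₀ (by positivity)]
    gcongr
  have hcompl : ∑ a ∈ (typicalSet p t)ᶜ, p a ≤ varentropy p / t ^ 2 := by
    rw [varentropy, Finset.sum_div]
    exact (Finset.sum_le_sum hcheb).trans (Finset.sum_le_univ_sum_of_nonneg fun a =>
      div_nonneg (mul_nonneg (hp.1 a) (sq_nonneg _)) (sq_nonneg _))
  linarith [Finset.sum_add_sum_compl (typicalSet p t) p, hp.2]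

end Typicality

section ProductWeights

variable {A J : Type*} [Fintype J]

/-- The weights of independent `J`-indexed samples from `p`. -/
def prodWeight (J : Type*) [Fintype J] (p : A → ℝ) (f : J → A) : ℝ := ∏ j, p (f j)

lemma prodWeight_mul_logb_comp (p : A → ℝ) (F : ℝ → ℝ) (f : J → A) :
    prodWeight J p f * F (Real.logb 2 (prodWeight J p f)) =
      prodWeight J p f * F (∑ j, Real.logb 2 (p (f j))) := by
  rcases eq_or_ne (prodWeight J p f) 0 with h0 | h0
  · rw [h0, zero_mul, zero_mul]
  · rw [← Real.logb_prod _ _ fun j _ => Finset.prod_ne_zero_iff.mp h0 j (Finset.mem_univ j)]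
    rfl

variable [Fintype A] [DecidableEq J]

lemma prodWeight_mem_stdSimplex {p : A → ℝ} (hp : p ∈ stdSimplex ℝ A) :
    prodWeight J p ∈ stdSimplex ℝ (J → A) := by
  refine ⟨fun f => Finset.prod_nonneg fun j _ => hp.1 (f j), ?_⟩
  simp only [prodWeight, ← Fintype.prod_sum fun _ a => p a, hp.2, Finset.prod_const_one]

lemma sum_prodWeight_mul_apply_mul_apply {p : A → ℝ} (hs : ∑ a, p a = 1) (u v : A → ℝ)
    (j k : J) : ∑ f, prodWeight J p f * (u (f j) * v (f k)) =
      if j = k then ∑ a, p a * (u a * v a) else (∑ a, p a * u a) * ∑ a, p a * v a := by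
  have hprod : ∀ f : J → A, prodWeight J p f * (u (f j) * v (f k)) =
      ∏ i, p (f i) * ((if i = j then u (f i) else 1) * (if i = k then v (f i) else 1)) := by
    intro f
    simp only [Finset.prod_mul_distrib, Finset.prod_ite_eq', Finset.mem_univ, if_true, prodWeight]
  simp only [hprod]
  rw [← Fintype.prod_sum
    fun i a => p a * ((if i = j then u a else 1) * (if i = k then v a else 1))]
  split_ifs with hjk
  · subst hjk
    rw [Fintype.prod_eq_single j fun i hi => by simp [hi, hs]]
    simp
  · rw [Fintype.prod_eq_mul j k hjk fun i hi => by simp [hi.1, hi.2, hs]]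
    simp [hjk, Ne.symm hjk]

lemma sum_prodWeight_mul_sum {p : A → ℝ} (hs : ∑ a, p a = 1) (g : A → ℝ) :
    ∑ f, prodWeight J p f * ∑ j, g (f j) = Fintype.card J * ∑ a, p a * g a := by
  have hmarginal : ∀ j : J, ∑ f, prodWeight J p f * g (f j) = ∑ a, p a * g a := fun j => by
    simpa using sum_prodWeight_mul_apply_mul_apply hs g 1 j j
  simp only [Finset.mul_sum]
  rw [Finset.sum_comm]
  simp [hmarginal, Finset.mul_sum]

lemma sum_prodWeight_mul_sum_sq {p g : A → ℝ} (hs : ∑ a, p a = 1) (hg : ∑ a, p a * g a = 0) :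
    ∑ f, prodWeight J p f * (∑ j, g (f j)) ^ 2 = Fintype.card J * ∑ a, p a * g a ^ 2 := by
  have hpair : ∀ j k : J, ∑ f, prodWeight J p f * (g (f j) * g (f k)) =
      if j = k then ∑ a, p a * g a ^ 2 else 0 := fun j k => by
    simp only [sum_prodWeight_mul_apply_mul_apply hs, hg, mul_zero, sq]
  calc ∑ f, prodWeight J p f * (∑ j, g (f j)) ^ 2
      = ∑ j, ∑ k, ∑ f, prodWeight J p f * (g (f j) * g (f k)) := by
        simp only [sq, Finset.sum_mul_sum]
        simp only [Finset.mul_sum]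
        rw [Finset.sum_comm]
        exact Finset.sum_congr rfl fun j _ => Finset.sum_comm
    _ = Fintype.card J * ∑ a, p a * g a ^ 2 := by simp [hpair]

lemma shannonEntropy_prodWeight {p : A → ℝ} (hs : ∑ a, p a = 1) :
    shannonEntropy (prodWeight J p) = Fintype.card J * shannonEntropy p := by
  have hlog := prodWeight_mul_logb_comp (J := J) p id
  simp only [id] at hlog
  simp only [shannonEntropy, hlog, sum_prodWeight_mul_sum hs fun a => Real.logb 2 (p a), mul_neg]

lemma varentropy_prodWeight {p : A → ℝ} (hs : ∑ a, p a = 1) :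
    varentropy (prodWeight J p) = Fintype.card J * varentropy p := by
  have hlog := prodWeight_mul_logb_comp (J := J) p
    fun x => (-x - Fintype.card J * shannonEntropy p) ^ 2
  rw [varentropy, shannonEntropy_prodWeight hs, varentropy,
    ← sum_prodWeight_mul_sum_sq hs (sum_mul_surprisal_sub_entropy hs)]
  refine Finset.sum_congr rfl fun f _ => (hlog f).trans ?_
  simp only [Finset.sum_sub_distrib, Finset.sum_neg_distrib, Finset.sum_const, Finset.card_univ,
    nsmul_eq_mul]

end ProductWeights

section Designs

variable {ι : Type} [Fintype ι] [DecidableEq ι]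

lemma map_eq_sum_mul_map_single (ℓ : Matrix ι ι ℂ →ₗ[ℂ] ℂ) (X : Matrix ι ι ℂ) :
    ℓ X = ∑ i, ∑ j, X i j * ℓ (single i j 1) := by
  have hsingle : ∀ i j, ℓ (single i j (X i j)) = X i j * ℓ (single i j 1) := fun i j => by
    rw [← smul_eq_mul, ← map_smul, smul_single, smul_eq_mul, mul_one]
  conv_lhs => rw [matrix_eq_sum_single X]
  simp only [map_sum, hsingle]

omit [Fintype ι] [DecidableEq ι] in
lemma integral_map_eq_map_of_integral [Finite ι] {Ω : Type*} [MeasurableSpace Ω] {μ : Measure Ω}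
    {F : Ω → Matrix ι ι ℂ} (hF : ∀ i j, Integrable (fun ω => F ω i j) μ)
    (ℓ : Matrix ι ι ℂ →ₗ[ℂ] ℂ) :
    ∫ ω, ℓ (F ω) ∂μ = ℓ (of fun i j => ∫ ω, F ω i j ∂μ) := by
  classical
  have := Fintype.ofFinite ι
  have hint : ∀ i j, Integrable (fun ω => F ω i j * ℓ (single i j 1)) μ :=
    fun i j => (hF i j).mul_const _
  simp only [map_eq_sum_mul_map_single ℓ (F _)]
  rw [map_eq_sum_mul_map_single,
    integral_finsetSum _ fun i _ => integrable_finsetSum _ fun j _ => hint i j]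
  simp only [integral_finsetSum _ fun j _ => hint _ j, integral_mul_const, of_apply]

instance : SecondCountableTopology (unitaryGroup ι ℂ) :=
  haveI : SecondCountableTopology (Matrix ι ι ℂ) :=
    inferInstanceAs (SecondCountableTopology (ι → ι → ℂ))
  (Topology.IsInducing.subtypeVal
    (Y := Matrix ι ι ℂ) (t := {U | U ∈ unitaryGroup ι ℂ})).secondCountableTopology

lemma continuous_unitary_entry (i j : ι) :
    Continuous fun U : unitaryGroup ι ℂ => (U : Matrix ι ι ℂ) i j :=
  continuous_subtype_val.matrix_elem i j

lemma integrable_of_continuous_unitaryGroup {E : Type*} [NormedAddCommGroup E]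
    {μ : Measure (unitaryGroup ι ℂ)} [IsFiniteMeasure μ] {f : unitaryGroup ι ℂ → E}
    (hf : Continuous f) : Integrable f μ :=
  hf.integrable_of_hasCompactSupport (HasCompactSupport.of_compactSpace f)

lemma integrable_unitary_entry_mul_star {μ : Measure (unitaryGroup ι ℂ)} [IsFiniteMeasure μ]
    (i j k l : ι) : Integrable (fun U : unitaryGroup ι ℂ =>
      (U : Matrix ι ι ℂ) i k * star ((U : Matrix ι ι ℂ) j l)) μ :=
  integrable_of_continuous_unitaryGroup
    ((continuous_unitary_entry i k).mul (continuous_unitary_entry j l).star)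

instance : IsProbabilityMeasure (haarUnitary ι) :=
  ⟨Measure.haarMeasure_self (G := unitaryGroup ι ℂ) (K₀ := ⊤)⟩

instance : (haarUnitary ι).IsMulLeftInvariant :=
  inferInstanceAs (Measure.haarMeasure _).IsMulLeftInvariant

lemma integral_haarUnitary_mul_left {V : Matrix ι ι ℂ} (hV : V ∈ unitaryGroup ι ℂ)
    (i j k l : ι) :
    ∫ U, (V * (U : Matrix ι ι ℂ)) i k * star ((V * (U : Matrix ι ι ℂ)) j l) ∂haarUnitary ι =
      ∫ U, (U : Matrix ι ι ℂ) i k * star ((U : Matrix ι ι ℂ) j l) ∂haarUnitary ι :=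
  integral_mul_left_eq_self (fun U : unitaryGroup ι ℂ =>
    (U : Matrix ι ι ℂ) i k * star ((U : Matrix ι ι ℂ) j l)) ⟨V, hV⟩

lemma permMatrix_mem_unitaryGroup (σ : Equiv.Perm ι) : σ.permMatrix ℂ ∈ unitaryGroup ι ℂ := by
  rw [mem_unitaryGroup_iff, star_eq_conjTranspose, conjTranspose_permMatrix, ← permMatrix_mul,
    inv_mul_cancel, permMatrix_one]

lemma integral_haarUnitary_row_eq (i j k l : ι) :
    ∫ U, (U : Matrix ι ι ℂ) i k * star ((U : Matrix ι ι ℂ) i l) ∂haarUnitary ι =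
      ∫ U, (U : Matrix ι ι ℂ) j k * star ((U : Matrix ι ι ℂ) j l) ∂haarUnitary ι := by
  simpa [Equiv.Perm.permMatrix, PEquiv.toMatrix_toPEquiv_mul] using
    integral_haarUnitary_mul_left (permMatrix_mem_unitaryGroup (Equiv.swap i j)) j j k l

lemma integral_haarUnitary_of_row_ne {i j : ι} (hij : i ≠ j) (k l : ι) :
    ∫ U, (U : Matrix ι ι ℂ) i k * star ((U : Matrix ι ι ℂ) j l) ∂haarUnitary ι = 0 := by
  let V : Matrix ι ι ℂ := diagonal fun x => if x = i then -1 else 1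
  have hV : V ∈ unitaryGroup ι ℂ := by
    rw [mem_unitaryGroup_iff, star_eq_conjTranspose, diagonal_conjTranspose,
      diagonal_mul_diagonal, ← diagonal_one]
    congr 1
    ext x
    simp only [Pi.star_apply]
    split_ifs <;> simp
  have hneg := integral_haarUnitary_mul_left hV i j k l
  simp only [V, diagonal_mul, if_true, if_neg hij.symm, neg_mul, one_mul, integral_neg] at hneg
  exact self_eq_neg.mp hneg.symm

lemma sum_unitary_entry_mul_star (U : unitaryGroup ι ℂ) (k l : ι) :
    ∑ i, (U : Matrix ι ι ℂ) i k * star ((U : Matrix ι ι ℂ) i l) = if k = l then 1 else 0 := by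
  have horth := congrFun (congrFun (mem_unitaryGroup_iff'.mp U.2) l) k
  simpa only [star_eq_conjTranspose, mul_apply, one_apply, conjTranspose_apply, mul_comm,
    eq_comm (a := l)] using horth

lemma integral_haarUnitary_entry_mul_star (i j k l : ι) :
    ∫ U, (U : Matrix ι ι ℂ) i k * star ((U : Matrix ι ι ℂ) j l) ∂haarUnitary ι =
      if i = j ∧ k = l then (Fintype.card ι : ℂ)⁻¹ else 0 := by
  rcases ne_or_eq i j with hij | rfl
  · rw [integral_haarUnitary_of_row_ne hij, if_neg fun h => hij h.1]
  have : Nonempty ι := ⟨i⟩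
  have hd : (Fintype.card ι : ℂ) ≠ 0 := Nat.cast_ne_zero.mpr Fintype.card_ne_zero
  have hsum : (Fintype.card ι : ℂ) *
      ∫ U, (U : Matrix ι ι ℂ) i k * star ((U : Matrix ι ι ℂ) i l) ∂haarUnitary ι =
      if k = l then 1 else 0 := by
    rw [← nsmul_eq_mul, ← Finset.card_univ, ← Finset.sum_const,
      Finset.sum_congr rfl fun j _ => integral_haarUnitary_row_eq i j k l,
      ← integral_finsetSum _ fun j _ => integrable_unitary_entry_mul_star j j k l]
    simp only [sum_unitary_entry_mul_star, integral_const, probReal_univ, one_smul]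
  rw [← mul_right_inj' hd, hsum]
  simp [hd]

namespace IsUnitaryDesign

variable {μ : Measure (unitaryGroup ι ℂ)}

lemma integral_entry_mul_star (hμ : IsUnitaryDesign 1 μ) (i j k l : ι) :
    ∫ U, (U : Matrix ι ι ℂ) i k * star ((U : Matrix ι ι ℂ) j l) ∂μ =
      if i = j ∧ k = l then (Fintype.card ι : ℂ)⁻¹ else 0 := by
  have hhom : IsBihomogeneous 1 (MvPolynomial.X (Sum.inl (i, k)) * MvPolynomial.X (Sum.inr (j, l)) :
      MvPolynomial ((ι × ι) ⊕ (ι × ι)) ℂ) :=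
    (MvPolynomial.isWeightedHomogeneous_X ℂ _ (Sum.inl (i, k))).mul
      (MvPolynomial.isWeightedHomogeneous_X ℂ _ (Sum.inr (j, l)))
  have hint := hμ.integral_eq _ hhom
  simp only [evalUnitary, map_mul, MvPolynomial.eval_X, Sum.elim_inl, Sum.elim_inr] at hint
  rw [hint, integral_haarUnitary_entry_mul_star]

lemma integral_unitaryConj_entry (hμ : IsUnitaryDesign 1 μ) (X : Matrix ι ι ℂ) (i j : ι) :
    ∫ U, unitaryConj U X i j ∂μ = if i = j then X.trace / Fintype.card ι else 0 := by
  have := hμ.isProbabilityMeasure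
  have hexpand : ∀ U : unitaryGroup ι ℂ, unitaryConj U X i j = ∑ k, ∑ l,
      (U : Matrix ι ι ℂ) i k * star ((U : Matrix ι ι ℂ) j l) * X k l := by
    intro U
    simp only [unitaryConj, LinearMap.coe_mk, AddHom.coe_mk, mul_apply, conjTranspose_apply,
      Finset.sum_mul]
    rw [Finset.sum_comm]
    simp only [mul_right_comm]
  have hint : ∀ k l, Integrable (fun U : unitaryGroup ι ℂ =>
      (U : Matrix ι ι ℂ) i k * star ((U : Matrix ι ι ℂ) j l) * X k l) μ := fun k l =>
    (integrable_unitary_entry_mul_star i j k l).mul_const _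
  simp only [hexpand]
  rw [integral_finsetSum _ fun k _ => integrable_finsetSum _ fun l _ => hint k l]
  simp only [integral_finsetSum _ fun l _ => hint _ l, integral_mul_const,
    hμ.integral_entry_mul_star]
  split_ifs with hij <;> simp [hij, trace, Finset.mul_sum, div_eq_inv_mul]

lemma integral_map_unitaryConj (hμ : IsUnitaryDesign 1 μ) (ℓ : Matrix ι ι ℂ →ₗ[ℂ] ℂ)
    (X : Matrix ι ι ℂ) :
    ∫ U, ℓ (unitaryConj U X) ∂μ = X.trace / Fintype.card ι * ℓ 1 := by
  have := hμ.isProbabilityMeasure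
  have hcont : Continuous fun U : unitaryGroup ι ℂ => unitaryConj U X :=
    (continuous_subtype_val.matrix_mul continuous_const).matrix_mul
      continuous_subtype_val.matrix_conjTranspose
  have hscalar : (of fun i j => ∫ U, unitaryConj U X i j ∂μ) =
      (X.trace / Fintype.card ι) • (1 : Matrix ι ι ℂ) := by
    ext i j
    simp [hμ.integral_unitaryConj_entry, one_apply]
  rw [integral_map_eq_map_of_integral fun i j =>
    integrable_of_continuous_unitaryGroup (hcont.matrix_elem i j), hscalar, map_smul, smul_eq_mul]

end IsUnitaryDesign

omit [Fintype ι] [DecidableEq ι] in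
lemma continuous_pureState : Continuous (pureState : EuclideanSpace ℂ ι → Matrix ι ι ℂ) :=
  continuous_matrix fun i j =>
    (EuclideanSpace.proj i : EuclideanSpace ℂ ι →L[ℂ] ℂ).continuous.mul
      (EuclideanSpace.proj j : EuclideanSpace ℂ ι →L[ℂ] ℂ).continuous.star

omit [Fintype ι] [DecidableEq ι] in
lemma continuous_map_pureState [Finite ι] (ℓ : Matrix ι ι ℂ →ₗ[ℂ] ℂ) :
    Continuous fun ψ : EuclideanSpace ℂ ι => ℓ (pureState ψ) :=
  ℓ.continuous_of_finiteDimensional.comp continuous_pureState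

omit [Fintype ι] [DecidableEq ι] in
lemma pureState_eq_vecMulVec (ψ : EuclideanSpace ℂ ι) :
    pureState ψ = vecMulVec ψ (star (ψ : ι → ℂ)) := rfl

omit [Fintype ι] [DecidableEq ι] in
lemma posSemidef_pureState [Finite ι] (ψ : EuclideanSpace ℂ ι) : (pureState ψ).PosSemidef :=
  posSemidef_vecMulVec_self_star _

omit [DecidableEq ι] in
lemma trace_pureState (ψ : EuclideanSpace ℂ ι) : (pureState ψ).trace = ((‖ψ‖ ^ 2 : ℝ) : ℂ) := by
  simp only [trace, diag, pureState, of_apply, EuclideanSpace.norm_sq_eq, Complex.ofReal_sum,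
    Complex.star_def, Complex.mul_conj, Complex.normSq_eq_norm_sq]

omit [DecidableEq ι] in
lemma trace_pureState_of_norm_eq_one {ψ : EuclideanSpace ℂ ι} (hψ : ‖ψ‖ = 1) :
    (pureState ψ).trace = 1 := by
  rw [trace_pureState, hψ, one_pow, Complex.ofReal_one]

lemma trace_unitaryConj (U : unitaryGroup ι ℂ) (X : Matrix ι ι ℂ) :
    (unitaryConj U X).trace = X.trace := by
  change ((U : Matrix ι ι ℂ) * X * star (U : Matrix ι ι ℂ)).trace = _
  rw [trace_mul_comm, ← Matrix.mul_assoc, Unitary.coe_star_mul_self, Matrix.one_mul]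

lemma pureState_toEuclideanLin (U : unitaryGroup ι ℂ) (ψ : EuclideanSpace ℂ ι) :
    pureState (toEuclideanLin (U : Matrix ι ι ℂ) ψ) = unitaryConj U (pureState ψ) := by
  change _ = (U : Matrix ι ι ℂ) * pureState ψ * (U : Matrix ι ι ℂ)ᴴ
  rw [pureState_eq_vecMulVec, pureState_eq_vecMulVec, mul_vecMulVec, vecMulVec_mul,
    ← star_mulVec]
  rfl

lemma norm_toEuclideanLin_unitary (U : unitaryGroup ι ℂ) (ψ : EuclideanSpace ℂ ι) :
    ‖toEuclideanLin (U : Matrix ι ι ℂ) ψ‖ = ‖ψ‖ := by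
  have htrace := trace_pureState (toEuclideanLin (U : Matrix ι ι ℂ) ψ)
  rw [pureState_toEuclideanLin, trace_unitaryConj, trace_pureState, Complex.ofReal_inj] at htrace
  exact ((sq_eq_sq₀ (norm_nonneg _) (norm_nonneg _)).mp htrace).symm

lemma continuous_toEuclideanLin_unitary (ψ : EuclideanSpace ℂ ι) :
    Continuous fun U : unitaryGroup ι ℂ => toEuclideanLin (U : Matrix ι ι ℂ) ψ :=
  (PiLp.continuous_toLp 2 _).comp (continuous_subtype_val.matrix_mulVec continuous_const)

namespace IsStateDesign

variable {t : ℕ} {ν : Measure (EuclideanSpace ℂ ι)}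

lemma isProbabilityMeasure (hν : IsStateDesign t ν) : IsProbabilityMeasure ν := by
  obtain ⟨φ₀, μ, -, hμ, rfl⟩ := hν
  have := hμ.isProbabilityMeasure
  exact Measure.isProbabilityMeasure_map (continuous_toEuclideanLin_unitary φ₀).aemeasurable

lemma ae_norm_eq_one (hν : IsStateDesign t ν) : ∀ᵐ ψ ∂ν, ‖ψ‖ = 1 := by
  obtain ⟨φ₀, μ, h0, -, rfl⟩ := hν
  rw [ae_map_iff (continuous_toEuclideanLin_unitary φ₀).aemeasurable
    (isClosed_eq continuous_norm continuous_const).measurableSet]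
  exact ae_of_all _ fun U => (norm_toEuclideanLin_unitary U φ₀).trans h0

lemma integrable_map_pureState (hν : IsStateDesign t ν) (ℓ : Matrix ι ι ℂ →ₗ[ℂ] ℂ) :
    Integrable (fun ψ => ℓ (pureState ψ)) ν := by
  obtain ⟨φ₀, μ, -, hμ, rfl⟩ := hν
  have := hμ.isProbabilityMeasure
  have hcont := continuous_map_pureState ℓ
  rw [integrable_map_measure hcont.aestronglyMeasurable
    (continuous_toEuclideanLin_unitary φ₀).aemeasurable]
  exact integrable_of_continuous_unitaryGroup (hcont.comp (continuous_toEuclideanLin_unitary φ₀))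

lemma integral_map_pureState (hν : IsStateDesign 1 ν) (ℓ : Matrix ι ι ℂ →ₗ[ℂ] ℂ) :
    ∫ ψ, ℓ (pureState ψ) ∂ν = ℓ 1 / Fintype.card ι := by
  obtain ⟨φ₀, μ, h0, hμ, rfl⟩ := hν
  rw [integral_map (continuous_toEuclideanLin_unitary φ₀).aemeasurable
    (continuous_map_pureState ℓ).aestronglyMeasurable]
  simp only [pureState_toEuclideanLin]
  rw [hμ.integral_map_unitaryConj, trace_pureState_of_norm_eq_one h0, one_div_mul_eq_div]

end IsStateDesign

end Designs

section Kraus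

variable {ι : Type} [Fintype ι] {A : Type*}

/-- The operators `K a` form a Kraus decomposition `Φ X = ∑ a, K a X (K a)†`. -/
def IsKrausFamily [Fintype A] (Φ : Matrix ι ι ℂ →ₗ[ℂ] Matrix ι ι ℂ) (K : A → Matrix ι ι ℂ) :
    Prop :=
  ∀ X, Φ X = ∑ a, K a * X * (K a)ᴴ

/-- The probability that the Kraus operator `K a` is applied to the maximally mixed state. -/
noncomputable def krausWeight (K : A → Matrix ι ι ℂ) (a : A) : ℝ :=
  (K a * (K a)ᴴ).trace.re / Fintype.card ι

lemma isKrausFamily_iff_eq_sum [Fintype A] {Φ : Matrix ι ι ℂ →ₗ[ℂ] Matrix ι ι ℂ}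
    {K : A → Matrix ι ι ℂ} : IsKrausFamily Φ K ↔
      Φ = ∑ a, LinearMap.mulRight ℂ (K a)ᴴ ∘ₗ LinearMap.mulLeft ℂ (K a) := by
  simp only [IsKrausFamily, LinearMap.ext_iff, LinearMap.sum_apply, LinearMap.comp_apply,
    LinearMap.mulLeft_apply, LinearMap.mulRight_apply]

lemma trace_mul_conjTranspose_eq_card_mul_krausWeight [Nonempty ι] (K : A → Matrix ι ι ℂ)
    (a : A) : (K a * (K a)ᴴ).trace = Fintype.card ι * (krausWeight K a : ℂ) := by
  have hreal : (((K a * (K a)ᴴ).trace.re : ℝ) : ℂ) = (K a * (K a)ᴴ).trace :=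
    Complex.ext rfl (Complex.nonneg_iff.mp
      (posSemidef_self_mul_conjTranspose (K a)).trace_nonneg).2
  have hd : (Fintype.card ι : ℂ) ≠ 0 := Nat.cast_ne_zero.mpr Fintype.card_ne_zero
  rw [krausWeight, Complex.ofReal_div, hreal, Complex.ofReal_natCast, mul_div_cancel₀ _ hd]

namespace IsKrausFamily

variable [Fintype A] {Φ : Matrix ι ι ℂ →ₗ[ℂ] Matrix ι ι ℂ} {K : A → Matrix ι ι ℂ}

lemma isPositiveTracePreserving (h : IsKrausFamily Φ K) (htrace : ∀ X, (Φ X).trace = X.trace) :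
    IsPositiveTracePreserving Φ where
  posSemidef X hX := by
    rw [h X]
    exact posSemidef_sum _ fun a _ => hX.mul_mul_conjTranspose_same _
  trace_map := htrace

lemma krausWeight_mem_stdSimplex [DecidableEq ι] [Nonempty ι] (h : IsKrausFamily Φ K)
    (hunital : IsUnital Φ) : krausWeight K ∈ stdSimplex ℝ A := by
  have hd : (Fintype.card ι : ℝ) ≠ 0 := Nat.cast_ne_zero.mpr Fintype.card_ne_zero
  refine ⟨fun a => div_nonneg (Complex.nonneg_iff.mp
    (posSemidef_self_mul_conjTranspose (K a)).trace_nonneg).1 (Nat.cast_nonneg _), ?_⟩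
  have hsum : ∑ a, K a * (K a)ᴴ = 1 := by
    rw [← hunital, h 1]
    simp only [Matrix.mul_one]
  simp only [krausWeight]
  rw [← Finset.sum_div, ← Complex.re_sum, ← trace_sum, hsum, trace_one, Complex.natCast_re,
    div_self hd]

end IsKrausFamily

end Kraus

section NoisyCircuit

variable {ι : Type} [Fintype ι] [DecidableEq ι] {Φ : Matrix ι ι ℂ →ₗ[ℂ] Matrix ι ι ℂ}

lemma isPositiveTracePreserving_unitaryConj (U : unitaryGroup ι ℂ) :
    IsPositiveTracePreserving (unitaryConj U) where
  posSemidef _ hX := hX.mul_mul_conjTranspose_same _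
  trace_map := trace_unitaryConj U

lemma isUnital_unitaryConj (U : unitaryGroup ι ℂ) : IsUnital (unitaryConj U) := by
  change (U : Matrix ι ι ℂ) * 1 * star (U : Matrix ι ι ℂ) = 1
  rw [Matrix.mul_one]
  exact Unitary.coe_mul_star_self U

lemma noisyCircuit_succ_apply (Φ : Matrix ι ι ℂ →ₗ[ℂ] Matrix ι ι ℂ) {D : ℕ}
    (U : Fin (D + 1) → unitaryGroup ι ℂ) (X : Matrix ι ι ℂ) :
    noisyCircuit Φ (D + 1) U X =
      Φ (unitaryConj (U (Fin.last D)) (noisyCircuit Φ D (fun k => U k.castSucc) X)) := rfl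

lemma isPositiveTracePreserving_noisyCircuit (hΦ : IsPositiveTracePreserving Φ) (D : ℕ)
    (U : Fin D → unitaryGroup ι ℂ) : IsPositiveTracePreserving (noisyCircuit Φ D U) := by
  induction D with
  | zero => exact ⟨fun _ hX => hX, fun _ => rfl⟩
  | succ D ih => exact hΦ.comp ((isPositiveTracePreserving_unitaryConj _).comp (ih _))

lemma isUnital_noisyCircuit (hΦ : IsUnital Φ) (D : ℕ) (U : Fin D → unitaryGroup ι ℂ) :
    IsUnital (noisyCircuit Φ D U) := by
  induction D with
  | zero => rfl
  | succ D ih =>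
    rw [IsUnital, noisyCircuit_succ_apply, ih, isUnital_unitaryConj, hΦ]

lemma continuous_noisyCircuit_apply (Φ : Matrix ι ι ℂ →ₗ[ℂ] Matrix ι ι ℂ) (D : ℕ) {Y : Type*}
    [TopologicalSpace Y] {u : Y → Fin D → unitaryGroup ι ℂ} {x : Y → Matrix ι ι ℂ}
    (hu : Continuous u) (hx : Continuous x) :
    Continuous fun y => noisyCircuit Φ D (u y) (x y) := by
  induction D with
  | zero => exact hx
  | succ D ih =>
    have hV : Continuous fun y => (u y (Fin.last D) : Matrix ι ι ℂ) :=
      continuous_subtype_val.comp ((continuous_apply _).comp hu)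
    have hinit := ih (u := fun y k => u y k.castSucc)
      (continuous_pi fun k => (continuous_apply _).comp hu)
    exact Φ.continuous_of_finiteDimensional.comp
      ((hV.matrix_mul hinit).matrix_mul hV.matrix_conjTranspose)

end NoisyCircuit

section KrausPaths

lemma integral_pi_eq_integral_integral_snoc {X E : Type*} [MeasurableSpace X]
    [NormedAddCommGroup E] [NormedSpace ℝ E] {D : ℕ} (μ : Fin (D + 1) → Measure X)
    [∀ k, SigmaFinite (μ k)] {f : (Fin (D + 1) → X) → E} (hf : Integrable f (Measure.pi μ)) :
    ∫ x, f x ∂Measure.pi μ =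
      ∫ y, ∫ x, f (Fin.snoc (α := fun _ => X) y x) ∂μ (Fin.last D)
        ∂Measure.pi fun k => μ k.castSucc := by
  have hmp := (measurePreserving_piFinSuccAbove μ (Fin.last D)).symm _
  have hsnoc : ∀ z : X × (Fin D → X), (MeasurableEquiv.piFinSuccAbove (fun _ => X)
      (Fin.last D)).symm z = Fin.snoc (α := fun _ => X) z.2 z.1 := fun z => by
    simp [MeasurableEquiv.piFinSuccAbove, Fin.insertNthEquiv]
  rw [← hmp.integral_comp (MeasurableEquiv.measurableEmbedding _) f,
    integral_prod_symm (fun z => f ((MeasurableEquiv.piFinSuccAbove _ (Fin.last D)).symm z))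
      (hmp.integrable_comp_of_integrable hf)]
  simp only [hsnoc, Fin.succAbove_last]

variable {ι : Type} [Fintype ι] [DecidableEq ι] {A : Type*}

/-- The product of the unitary layers and of one choice of a Kraus operator after each layer:
the Kraus operators of a noisy circuit, labelled by the paths `α : Fin D → A`. -/
def krausPath (K : A → Matrix ι ι ℂ) :
    (D : ℕ) → (Fin D → A) → (Fin D → unitaryGroup ι ℂ) → Matrix ι ι ℂ
  | 0, _, _ => 1
  | D + 1, α, U => K (α (Fin.last D)) * (U (Fin.last D) : Matrix ι ι ℂ) *
      krausPath K D (fun k => α k.castSucc) (fun k => U k.castSucc)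

lemma isKrausFamily_krausPath [Fintype A] {Φ : Matrix ι ι ℂ →ₗ[ℂ] Matrix ι ι ℂ}
    {K : A → Matrix ι ι ℂ} (h : IsKrausFamily Φ K) (D : ℕ) (U : Fin D → unitaryGroup ι ℂ) :
    IsKrausFamily (noisyCircuit Φ D U) fun α => krausPath K D α U := by
  intro X
  induction D with
  | zero => simp [noisyCircuit, krausPath]
  | succ D ih =>
    rw [noisyCircuit_succ_apply, ih, h, ← (Fin.snocEquiv fun _ : Fin (D + 1) => A).sum_comp,
      Fintype.sum_prod_type]
    refine Finset.sum_congr rfl fun a _ => ?_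
    rw [map_sum, Matrix.mul_sum, Matrix.sum_mul]
    simp [krausPath, unitaryConj, Fin.snocEquiv, conjTranspose_mul, Matrix.mul_assoc]

lemma continuous_krausPath (K : A → Matrix ι ι ℂ) (D : ℕ) (α : Fin D → A) :
    Continuous (krausPath K D α) := by
  induction D with
  | zero => exact continuous_const
  | succ D ih =>
    exact (continuous_const.matrix_mul
      (continuous_subtype_val.comp (continuous_apply (Fin.last D)))).matrix_mul
      ((ih _).comp (continuous_pi fun k => continuous_apply k.castSucc))

lemma continuous_trace_krausPath (K : A → Matrix ι ι ℂ) (D : ℕ) (α : Fin D → A)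
    (X : Matrix ι ι ℂ) : Continuous fun U : Fin D → unitaryGroup ι ℂ =>
      (krausPath K D α U * X * (krausPath K D α U)ᴴ).trace :=
  (((continuous_krausPath K D α).matrix_mul continuous_const).matrix_mul
    (continuous_krausPath K D α).matrix_conjTranspose).matrix_trace

lemma integrable_trace_krausPath (K : A → Matrix ι ι ℂ) {D : ℕ}
    (μ : Fin D → Measure (unitaryGroup ι ℂ)) [∀ k, IsFiniteMeasure (μ k)] (α : Fin D → A)
    (X : Matrix ι ι ℂ) :
    Integrable (fun U => (krausPath K D α U * X * (krausPath K D α U)ᴴ).trace)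
      (Measure.pi μ) :=
  (continuous_trace_krausPath K D α X).integrable_of_hasCompactSupport
    (HasCompactSupport.of_compactSpace _)

lemma IsUnitaryDesign.integral_trace_kraus_unitaryConj [Nonempty ι]
    {μ : Measure (unitaryGroup ι ℂ)} (hμ : IsUnitaryDesign 1 μ) (K : A → Matrix ι ι ℂ) (a : A)
    (X : Matrix ι ι ℂ) :
    ∫ U, (K a * unitaryConj U X * (K a)ᴴ).trace ∂μ = krausWeight K a * X.trace := by
  have hd : (Fintype.card ι : ℂ) ≠ 0 := Nat.cast_ne_zero.mpr Fintype.card_ne_zero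
  have h := hμ.integral_map_unitaryConj
    (traceLinearMap ι ℂ ℂ ∘ₗ LinearMap.mulLeftRight ℂ (K a, (K a)ᴴ)) X
  simp only [LinearMap.comp_apply, LinearMap.mulLeftRight_apply, traceLinearMap_apply,
    Matrix.mul_one, trace_mul_conjTranspose_eq_card_mul_krausWeight] at h
  rw [h]
  field_simp

/-- Under `1`-designs the Kraus operators along a path are chosen independently. -/
lemma integral_trace_krausPath [Nonempty ι] (K : A → Matrix ι ι ℂ) {D : ℕ}
    {μ : Fin D → Measure (unitaryGroup ι ℂ)} (hμ : ∀ k, IsUnitaryDesign 1 (μ k))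
    (α : Fin D → A) (X : Matrix ι ι ℂ) :
    ∫ U, (krausPath K D α U * X * (krausPath K D α U)ᴴ).trace ∂Measure.pi μ =
      (prodWeight (Fin D) (krausWeight K) α : ℂ) * X.trace := by
  have := fun k => (hμ k).isProbabilityMeasure
  induction D with
  | zero => simp [krausPath, prodWeight]
  | succ D ih =>
    have hsnoc : ∀ U u, (krausPath K (D + 1) α (Fin.snoc U u) * X *
        (krausPath K (D + 1) α (Fin.snoc U u))ᴴ).trace =
        (K (α (Fin.last D)) * unitaryConj u (krausPath K D (fun k => α k.castSucc) U * X *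
          (krausPath K D (fun k => α k.castSucc) U)ᴴ) * (K (α (Fin.last D)))ᴴ).trace := by
      intro U u
      simp [krausPath, unitaryConj, conjTranspose_mul, Matrix.mul_assoc]
    rw [integral_pi_eq_integral_integral_snoc μ (integrable_trace_krausPath K μ α X)]
    simp only [hsnoc, (hμ _).integral_trace_kraus_unitaryConj, integral_const_mul]
    rw [ih (fun k => hμ k.castSucc) _ fun k => this _, prodWeight, prodWeight,
      Fin.prod_univ_castSucc]
    push_cast
    ring

end KrausPaths

section ContractionRatio

variable {ι : Type} [Fintype ι] [DecidableEq ι] {T : Matrix ι ι ℂ →ₗ[ℂ] Matrix ι ι ℂ}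

lemma contractionRatio_nonneg (T : Matrix ι ι ℂ →ₗ[ℂ] Matrix ι ι ℂ) (ψ φ : EuclideanSpace ℂ ι) :
    0 ≤ contractionRatio T ψ φ :=
  div_nonneg (traceNorm_nonneg _) (traceNorm_nonneg _)

omit [Fintype ι] [DecidableEq ι] in
lemma isHermitian_pureState_sub [Finite ι] (ψ φ : EuclideanSpace ℂ ι) :
    (pureState ψ - pureState φ).IsHermitian :=
  (posSemidef_pureState ψ).1.sub (posSemidef_pureState φ).1

namespace IsPositiveTracePreserving

omit [DecidableEq ι] in
lemma isHermitian_map_pureState_sub (hT : IsPositiveTracePreserving T)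
    (ψ φ : EuclideanSpace ℂ ι) : (T (pureState ψ) - T (pureState φ)).IsHermitian :=
  (hT.posSemidef (posSemidef_pureState ψ)).1.sub (hT.posSemidef (posSemidef_pureState φ)).1

lemma traceNorm_map_pureState_sub_le (hT : IsPositiveTracePreserving T)
    (ψ φ : EuclideanSpace ℂ ι) :
    traceNorm (T (pureState ψ) - T (pureState φ)) ≤ traceNorm (pureState ψ - pureState φ) := by
  rw [← map_sub]
  exact hT.traceNorm_map_le (isHermitian_pureState_sub ψ φ)

lemma contractionRatio_le_one (hT : IsPositiveTracePreserving T) (ψ φ : EuclideanSpace ℂ ι) :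
    contractionRatio T ψ φ ≤ 1 :=
  div_le_one_of_le₀ (hT.traceNorm_map_pureState_sub_le ψ φ) (traceNorm_nonneg _)

lemma half_traceNorm_le_contractionRatio (hT : IsPositiveTracePreserving T)
    {ψ φ : EuclideanSpace ℂ ι} (hψ : ‖ψ‖ = 1) (hφ : ‖φ‖ = 1) :
    traceNorm (T (pureState ψ) - T (pureState φ)) / 2 ≤ contractionRatio T ψ φ := by
  have htwo : traceNorm (pureState ψ - pureState φ) ≤ 2 := by
    refine (traceNorm_sub_le_re_trace_add (posSemidef_pureState ψ)
      (posSemidef_pureState φ)).trans_eq ?_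
    rw [trace_pureState_of_norm_eq_one hψ, trace_pureState_of_norm_eq_one hφ, Complex.one_re]
    norm_num
  rcases (traceNorm_nonneg (pureState ψ - pureState φ)).eq_or_lt with h0 | h0
  · have hle := hT.traceNorm_map_pureState_sub_le ψ φ
    rw [← h0] at hle
    linarith [contractionRatio_nonneg T ψ φ]
  · exact div_le_div_of_nonneg_left (traceNorm_nonneg _) h0 htwo

lemma re_trace_mul_sub_le_contractionRatio (hT : IsPositiveTracePreserving T)
    {ψ φ : EuclideanSpace ℂ ι} (hψ : ‖ψ‖ = 1) (hφ : ‖φ‖ = 1) {P : Matrix ι ι ℂ}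
    (hP : IsStarProjection P) :
    (P * T (pureState ψ)).trace.re - (P * T (pureState φ)).trace.re ≤
      contractionRatio T ψ φ := by
  have hbias := two_mul_re_trace_mul_le_traceNorm hP (hT.isHermitian_map_pureState_sub ψ φ) (by
    rw [trace_sub, hT.trace_map, hT.trace_map, trace_pureState_of_norm_eq_one hψ,
      trace_pureState_of_norm_eq_one hφ, sub_self])
  rw [Matrix.mul_sub, trace_sub, Complex.sub_re] at hbias
  linarith [hT.half_traceNorm_le_contractionRatio hψ hφ]

end IsPositiveTracePreserving

lemma integrable_contractionRatio {Y : Type*} [TopologicalSpace Y] [MeasurableSpace Y]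
    [OpensMeasurableSpace Y] {m : Measure Y} [IsFiniteMeasure m]
    {T : Y → Matrix ι ι ℂ →ₗ[ℂ] Matrix ι ι ℂ} {ψ φ : Y → EuclideanSpace ℂ ι}
    (hT : ∀ y, IsPositiveTracePreserving (T y)) (hψ : Continuous ψ) (hφ : Continuous φ)
    (hTψ : Continuous fun y => T y (pureState (ψ y)))
    (hTφ : Continuous fun y => T y (pureState (φ y))) :
    Integrable (fun y => contractionRatio (T y) (ψ y) (φ y)) m := by
  have hmeas : Measurable fun y => contractionRatio (T y) (ψ y) (φ y) :=
    (measurable_traceNorm (hTψ.sub hTφ) fun y => (hT y).isHermitian_map_pureState_sub _ _).div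
      (measurable_traceNorm ((continuous_pureState.comp hψ).sub (continuous_pureState.comp hφ))
        fun y => isHermitian_pureState_sub _ _)
  refine Integrable.of_bound hmeas.aestronglyMeasurable 1 (ae_of_all _ fun y => ?_)
  rw [Real.norm_of_nonneg (contractionRatio_nonneg _ _ _)]
  exact (hT y).contractionRatio_le_one _ _

end ContractionRatio

section ProjectionTest

variable {ι : Type} [Fintype ι] {T : Matrix ι ι ℂ →ₗ[ℂ] Matrix ι ι ℂ}

lemma re_trace_mul_nonneg_of_isStarProjection {P X : Matrix ι ι ℂ} (hP : IsStarProjection P)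
    (hX : X.PosSemidef) : 0 ≤ (P * X).trace.re := by
  have hcompress : (P * X).trace = (P * X * Pᴴ).trace := by
    rw [← star_eq_conjTranspose, hP.isSelfAdjoint.star_eq, trace_mul_comm (P * X),
      ← Matrix.mul_assoc, hP.isIdempotentElem.eq]
  rw [hcompress]
  exact (Complex.nonneg_iff.mp (hX.mul_mul_conjTranspose_same P).trace_nonneg).1

lemma IsKrausFamily.sum_re_trace_le_re_trace_mul {B : Type*} [Fintype B]
    {L : B → Matrix ι ι ℂ} (h : IsKrausFamily T L) {G : Finset B} {ψ : EuclideanSpace ℂ ι}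
    {P : Matrix ι ι ℂ} (hP : IsStarProjection P) (hG : ∀ b ∈ G, P *ᵥ (L b *ᵥ ψ) = L b *ᵥ ψ) :
    ∑ b ∈ G, (L b * pureState ψ * (L b)ᴴ).trace.re ≤ (P * T (pureState ψ)).trace.re := by
  have hfix : ∀ b ∈ G, P * (L b * pureState ψ * (L b)ᴴ) = L b * pureState ψ * (L b)ᴴ := by
    intro b hb
    rw [pureState_eq_vecMulVec, mul_vecMulVec, vecMulVec_mul, mul_vecMulVec, hG b hb]
  calc ∑ b ∈ G, (L b * pureState ψ * (L b)ᴴ).trace.re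
      = ∑ b ∈ G, (P * (L b * pureState ψ * (L b)ᴴ)).trace.re :=
        Finset.sum_congr rfl fun b hb => by rw [hfix b hb]
    _ ≤ ∑ b, (P * (L b * pureState ψ * (L b)ᴴ)).trace.re :=
        Finset.sum_le_univ_sum_of_nonneg fun b => re_trace_mul_nonneg_of_isStarProjection hP
          ((posSemidef_pureState ψ).mul_mul_conjTranspose_same _)
    _ = (P * T (pureState ψ)).trace.re := by
        rw [h, Matrix.mul_sum, trace_sum, Complex.re_sum]

namespace IsStateDesign

variable [DecidableEq ι] {ν : Measure (EuclideanSpace ℂ ι)} {ψ : EuclideanSpace ℂ ι}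

lemma integrable_re_trace_mul_map_pureState (hν : IsStateDesign 1 ν)
    (T : Matrix ι ι ℂ →ₗ[ℂ] Matrix ι ι ℂ) (P : Matrix ι ι ℂ) :
    Integrable (fun φ => (P * T (pureState φ)).trace.re) ν :=
  (hν.integrable_map_pureState (traceLinearMap ι ℂ ℂ ∘ₗ LinearMap.mulLeft ℂ P ∘ₗ T)).re

lemma integral_re_trace_mul_map_pureState (hν : IsStateDesign 1 ν) (hunital : IsUnital T)
    (P : Matrix ι ι ℂ) :
    ∫ φ, (P * T (pureState φ)).trace.re ∂ν = P.trace.re / Fintype.card ι := by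
  have hint := hν.integral_map_pureState (traceLinearMap ι ℂ ℂ ∘ₗ LinearMap.mulLeft ℂ P ∘ₗ T)
  have hre := Complex.reCLM.integral_comp_comm
    (hν.integrable_map_pureState (traceLinearMap ι ℂ ℂ ∘ₗ LinearMap.mulLeft ℂ P ∘ₗ T))
  simp only [LinearMap.comp_apply, LinearMap.mulLeft_apply, traceLinearMap_apply,
    Complex.reCLM_apply] at hint hre
  rw [hre, hint, hunital, Matrix.mul_one, Complex.div_natCast_re]

lemma re_trace_mul_sub_le_integral_contractionRatio (hν : IsStateDesign 1 ν)
    (hT : IsPositiveTracePreserving T) (hunital : IsUnital T) (hψ : ‖ψ‖ = 1) {P : Matrix ι ι ℂ}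
    (hP : IsStarProjection P) :
    (P * T (pureState ψ)).trace.re - P.trace.re / Fintype.card ι ≤
      ∫ φ, contractionRatio T ψ φ ∂ν := by
  have := hν.isProbabilityMeasure
  have hint := hν.integrable_re_trace_mul_map_pureState T P
  calc (P * T (pureState ψ)).trace.re - P.trace.re / Fintype.card ι
      = ∫ φ, ((P * T (pureState ψ)).trace.re - (P * T (pureState φ)).trace.re) ∂ν := by
        rw [integral_sub (integrable_const _) hint,
          hν.integral_re_trace_mul_map_pureState hunital, integral_const, probReal_univ, one_smul]
    _ ≤ ∫ φ, contractionRatio T ψ φ ∂ν := by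
        refine integral_mono_ae ((integrable_const _).sub hint)
          (integrable_contractionRatio (fun _ => hT) continuous_const continuous_id
            continuous_const (T.continuous_of_finiteDimensional.comp continuous_pureState)) ?_
        filter_upwards [hν.ae_norm_eq_one] with φ hφ
        exact hT.re_trace_mul_sub_le_contractionRatio hψ hφ hP

/-- The test is the projection onto the span of the vectors `L b ψ` with `b ∈ G`. -/
lemma sum_re_trace_sub_le_integral_contractionRatio {B : Type*} [Fintype B]
    {L : B → Matrix ι ι ℂ} (hν : IsStateDesign 1 ν) (hL : IsKrausFamily T L)
    (hT : IsPositiveTracePreserving T) (hunital : IsUnital T) (hψ : ‖ψ‖ = 1) (G : Finset B) :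
    ∑ b ∈ G, (L b * pureState ψ * (L b)ᴴ).trace.re - G.card / Fintype.card ι ≤
      ∫ φ, contractionRatio T ψ φ ∂ν := by
  obtain ⟨P, hP, hfix, hrank⟩ := exists_isStarProjection_of_finset G fun b => L b *ᵥ ψ
  refine le_trans ?_ (hν.re_trace_mul_sub_le_integral_contractionRatio hT hunital hψ hP)
  gcongr
  exact hL.sum_re_trace_le_re_trace_mul hP hfix

end IsStateDesign

end ProjectionTest

section AverageContraction

variable {ι : Type} [Fintype ι] [DecidableEq ι] {Φ : Matrix ι ι ℂ →ₗ[ℂ] Matrix ι ι ℂ} {D : ℕ}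
  {ν₁ ν₂ : Measure (EuclideanSpace ℂ ι)} {μ : Fin D → Measure (unitaryGroup ι ℂ)}

lemma integrable_contractionRatio_noisyCircuit (hΦ : IsPositiveTracePreserving Φ) {Y : Type*}
    [TopologicalSpace Y] [MeasurableSpace Y] [OpensMeasurableSpace Y] {m : Measure Y}
    [IsFiniteMeasure m] {u : Y → Fin D → unitaryGroup ι ℂ} {ψ φ : Y → EuclideanSpace ℂ ι}
    (hu : Continuous u) (hψ : Continuous ψ) (hφ : Continuous φ) :
    Integrable (fun y => contractionRatio (noisyCircuit Φ D (u y)) (ψ y) (φ y)) m :=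
  integrable_contractionRatio (fun _ => isPositiveTracePreserving_noisyCircuit hΦ D _) hψ hφ
    (continuous_noisyCircuit_apply Φ D hu (continuous_pureState.comp hψ))
    (continuous_noisyCircuit_apply Φ D hu (continuous_pureState.comp hφ))

lemma integrable_contractionRatio_noisyCircuit_prod (hΦ : IsPositiveTracePreserving Φ)
    [IsFiniteMeasure ν₁] [IsFiniteMeasure ν₂] [∀ k, IsFiniteMeasure (μ k)] :
    Integrable (fun ω : EuclideanSpace ℂ ι × EuclideanSpace ℂ ι × (Fin D → unitaryGroup ι ℂ) =>
      contractionRatio (noisyCircuit Φ D ω.2.2) ω.1 ω.2.1) (ν₁.prod (ν₂.prod (Measure.pi μ))) :=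
  integrable_contractionRatio_noisyCircuit hΦ (continuous_snd.comp continuous_snd)
    continuous_fst (continuous_fst.comp continuous_snd)

lemma averageContraction_le_one (hΦ : IsPositiveTracePreserving Φ) [IsProbabilityMeasure ν₁]
    [IsProbabilityMeasure ν₂] [∀ k, IsProbabilityMeasure (μ k)] :
    averageContraction Φ D ν₁ ν₂ μ ≤ 1 := by
  refine (integral_mono (integrable_contractionRatio_noisyCircuit_prod hΦ) (integrable_const 1)
    fun ω => (isPositiveTracePreserving_noisyCircuit hΦ D _).contractionRatio_le_one _ _).trans_eq
      ?_
  rw [integral_const, probReal_univ, one_smul]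

variable {A : Type*} {K : A → Matrix ι ι ℂ} [Nonempty ι]

lemma integral_re_trace_krausPath (hμ : ∀ k, IsUnitaryDesign 1 (μ k)) (α : Fin D → A)
    {ψ : EuclideanSpace ℂ ι} (hψ : ‖ψ‖ = 1) :
    ∫ U, (krausPath K D α U * pureState ψ * (krausPath K D α U)ᴴ).trace.re ∂Measure.pi μ =
      prodWeight (Fin D) (krausWeight K) α := by
  have := fun k => (hμ k).isProbabilityMeasure
  have hre := Complex.reCLM.integral_comp_comm
    (integrable_trace_krausPath K μ α (pureState ψ))
  simp only [Complex.reCLM_apply] at hre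
  rw [hre, integral_trace_krausPath K hμ, trace_pureState_of_norm_eq_one hψ, mul_one,
    Complex.ofReal_re]

variable [Fintype A]

lemma sum_prodWeight_sub_le_integral_contractionRatio (hK : IsKrausFamily Φ K)
    (hΦ : IsPositiveTracePreserving Φ) (hunital : IsUnital Φ) (hν₂ : IsStateDesign 1 ν₂)
    (hμ : ∀ k, IsUnitaryDesign 1 (μ k)) {ψ : EuclideanSpace ℂ ι} (hψ : ‖ψ‖ = 1)
    (G : Finset (Fin D → A)) :
    ∑ α ∈ G, prodWeight (Fin D) (krausWeight K) α - G.card / Fintype.card ι ≤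
      ∫ ω, contractionRatio (noisyCircuit Φ D ω.2) ψ ω.1 ∂ν₂.prod (Measure.pi μ) := by
  have := hν₂.isProbabilityMeasure
  have := fun k => (hμ k).isProbabilityMeasure
  have hint : ∀ α ∈ G, Integrable (fun U => (krausPath K D α U * pureState ψ *
      (krausPath K D α U)ᴴ).trace.re) (Measure.pi μ) := fun α _ =>
    (integrable_trace_krausPath K μ α (pureState ψ)).re
  have hratio : Integrable (fun ω : EuclideanSpace ℂ ι × (Fin D → unitaryGroup ι ℂ) =>
      contractionRatio (noisyCircuit Φ D ω.2) ψ ω.1) (ν₂.prod (Measure.pi μ)) :=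
    integrable_contractionRatio_noisyCircuit hΦ continuous_snd continuous_const continuous_fst
  rw [integral_prod_symm _ hratio]
  calc ∑ α ∈ G, prodWeight (Fin D) (krausWeight K) α - (G.card : ℝ) / Fintype.card ι
      = ∫ U, (∑ α ∈ G, (krausPath K D α U * pureState ψ * (krausPath K D α U)ᴴ).trace.re -
          (G.card : ℝ) / Fintype.card ι) ∂Measure.pi μ := by
        rw [integral_sub (integrable_finsetSum _ hint) (integrable_const _),
          integral_finsetSum _ hint, integral_const, probReal_univ, one_smul]
        simp only [integral_re_trace_krausPath hμ _ hψ]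
    _ ≤ ∫ U, ∫ φ, contractionRatio (noisyCircuit Φ D U) ψ φ ∂ν₂ ∂Measure.pi μ :=
        integral_mono ((integrable_finsetSum _ hint).sub (integrable_const _))
          hratio.integral_prod_right
          fun U => hν₂.sum_re_trace_sub_le_integral_contractionRatio
            (isKrausFamily_krausPath hK D U) (isPositiveTracePreserving_noisyCircuit hΦ D U)
            (isUnital_noisyCircuit hunital D U) hψ G

lemma sum_prodWeight_sub_le_averageContraction (hK : IsKrausFamily Φ K)
    (hΦ : IsPositiveTracePreserving Φ) (hunital : IsUnital Φ) [IsProbabilityMeasure ν₁]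
    (hν₁ : ∀ᵐ ψ ∂ν₁, ‖ψ‖ = 1) (hν₂ : IsStateDesign 1 ν₂) (hμ : ∀ k, IsUnitaryDesign 1 (μ k))
    (G : Finset (Fin D → A)) :
    ∑ α ∈ G, prodWeight (Fin D) (krausWeight K) α - G.card / Fintype.card ι ≤
      averageContraction Φ D ν₁ ν₂ μ := by
  have := hν₂.isProbabilityMeasure
  have := fun k => (hμ k).isProbabilityMeasure
  have hratio := integrable_contractionRatio_noisyCircuit_prod (ν₁ := ν₁) (ν₂ := ν₂) (μ := μ) hΦ
  calc ∑ α ∈ G, prodWeight (Fin D) (krausWeight K) α - (G.card : ℝ) / Fintype.card ι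
      = ∫ _, (∑ α ∈ G, prodWeight (Fin D) (krausWeight K) α -
          (G.card : ℝ) / Fintype.card ι) ∂ν₁ := by
        rw [integral_const, probReal_univ, one_smul]
    _ ≤ ∫ ψ, ∫ ω, contractionRatio (noisyCircuit Φ D ω.2) ψ ω.1 ∂ν₂.prod (Measure.pi μ) ∂ν₁ := by
        refine integral_mono_ae (integrable_const _) hratio.integral_prod_left ?_
        filter_upwards [hν₁] with ψ hψ
        exact sum_prodWeight_sub_le_integral_contractionRatio hK hΦ hunital hν₂ hμ hψ G
    _ = averageContraction Φ D ν₁ ν₂ μ := (integral_prod _ hratio).symm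

lemma one_sub_sub_rpow_le_averageContraction (hK : IsKrausFamily Φ K)
    (hΦ : IsPositiveTracePreserving Φ) (hunital : IsUnital Φ) [IsProbabilityMeasure ν₁]
    (hν₁ : ∀ᵐ ψ ∂ν₁, ‖ψ‖ = 1) (hν₂ : IsStateDesign 1 ν₂) (hμ : ∀ k, IsUnitaryDesign 1 (μ k))
    {t : ℝ} (ht : 0 < t) :
    1 - D * varentropy (krausWeight K) / t ^ 2 -
        2 ^ (D * shannonEntropy (krausWeight K) + t - Real.logb 2 (Fintype.card ι)) ≤
      averageContraction Φ D ν₁ ν₂ μ := by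
  have hp := hK.krausWeight_mem_stdSimplex hunital
  have hpath := prodWeight_mem_stdSimplex (J := Fin D) hp
  have hmass := one_sub_varentropy_div_le_sum_typicalSet hpath ht
  have hcard := card_typicalSet_le hpath t
  rw [varentropy_prodWeight hp.2, Fintype.card_fin] at hmass
  rw [shannonEntropy_prodWeight hp.2, Fintype.card_fin] at hcard
  have hd : (0 : ℝ) < Fintype.card ι := Nat.cast_pos.mpr Fintype.card_pos
  refine le_trans ?_ (sum_prodWeight_sub_le_averageContraction hK hΦ hunital hν₁ hν₂ hμ
    (typicalSet (prodWeight (Fin D) (krausWeight K)) t))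
  rw [Real.rpow_sub two_pos, Real.rpow_logb two_pos (by norm_num) hd]
  gcongr

end AverageContraction

section Choi

variable {ι : Type} [Fintype ι] [DecidableEq ι] {Φ : Matrix ι ι ℂ →ₗ[ℂ] Matrix ι ι ℂ}

lemma choiState_apply (Φ : Matrix ι ι ℂ →ₗ[ℂ] Matrix ι ι ℂ) (i j k l : ι) :
    choiState Φ (i, k) (j, l) = (Fintype.card ι : ℂ)⁻¹ * Φ (single k l 1) i j := by
  have hsqrt : ((√(Fintype.card ι : ℝ) : ℝ) : ℂ)⁻¹ * ((√(Fintype.card ι : ℝ) : ℝ) : ℂ)⁻¹ =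
      (Fintype.card ι : ℂ)⁻¹ := by
    rw [← mul_inv, ← Complex.ofReal_mul, Real.mul_self_sqrt (Nat.cast_nonneg _),
      Complex.ofReal_natCast]
  have hblock : (of fun i j : ι => vecMulVec (maxEntangled ι) (star (maxEntangled ι))
      (i, k) (j, l)) = (Fintype.card ι : ℂ)⁻¹ • single k l 1 := by
    ext i j
    simp only [of_apply, vecMulVec_apply, maxEntangled, Pi.star_apply, Matrix.smul_apply,
      single_apply, smul_eq_mul, eq_comm (a := k), eq_comm (a := l)]
    by_cases hik : i = k <;> by_cases hjl : j = l <;> simp [hik, hjl, hsqrt]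
  change Φ (of fun i j : ι => vecMulVec (maxEntangled ι) (star (maxEntangled ι))
    (i, k) (j, l)) i j = _
  rw [hblock, map_smul, Matrix.smul_apply, smul_eq_mul]

lemma isKrausFamily_of_apply_single {A : Type*} [Fintype A] {K : A → Matrix ι ι ℂ}
    (h : ∀ i j k l, Φ (single k l 1) i j = ∑ a, K a i k * star (K a j l)) :
    IsKrausFamily Φ K := by
  refine isKrausFamily_iff_eq_sum.mpr (Matrix.ext_linearMap ℂ fun k l => LinearMap.ext_ring ?_)
  ext i j
  simp [h, Matrix.sum_apply, Matrix.mul_apply, single_apply, ite_and]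

lemma IsQuantumChannel.posSemidef_choiState (hΦ : IsQuantumChannel Φ) :
    (choiState Φ).PosSemidef :=
  hΦ.completelyPositive ι _ (posSemidef_vecMulVec_self_star _)

/-- The canonical Kraus operators of a completely positive map: the eigenvectors of its Choi
state, read as matrices and scaled by `√(d λ)` for the eigenvalue `λ`. -/
noncomputable def choiKraus (h : (choiState Φ).IsHermitian) (a : ι × ι) : Matrix ι ι ℂ :=
  of fun i j => (√(Fintype.card ι * h.eigenvalues a) : ℂ) * h.eigenvectorBasis a (i, j)

lemma choiKraus_apply_mul_star (h : (choiState Φ).PosSemidef) (a : ι × ι) (i j k l : ι) :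
    choiKraus h.1 a i k * star (choiKraus h.1 a j l) = Fintype.card ι * (h.1.eigenvalues a *
      (h.1.eigenvectorBasis a (i, k) * star (h.1.eigenvectorBasis a (j, l)))) := by
  have hsqrt : (√(Fintype.card ι * h.1.eigenvalues a) : ℂ) *
      (√(Fintype.card ι * h.1.eigenvalues a) : ℂ) = Fintype.card ι * h.1.eigenvalues a := by
    rw [← Complex.ofReal_mul, Real.mul_self_sqrt (mul_nonneg (Nat.cast_nonneg _)
      (h.eigenvalues_nonneg a)), Complex.ofReal_mul, Complex.ofReal_natCast]
  simp only [choiKraus, of_apply, star_mul', Complex.star_def, Complex.conj_ofReal]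
  linear_combination (h.1.eigenvectorBasis a (i, k) *
    (starRingEnd ℂ) (h.1.eigenvectorBasis a (j, l))) * hsqrt

lemma apply_eq_sum_eigenvalues_mul {κ : Type*} [Fintype κ] [DecidableEq κ] {M : Matrix κ κ ℂ}
    (h : M.IsHermitian) (x y : κ) :
    M x y = ∑ a, (h.eigenvalues a : ℂ) *
      (h.eigenvectorBasis a x * star (h.eigenvectorBasis a y)) := by
  conv_lhs => rw [h.spectral_theorem, Unitary.conjStarAlgAut_apply, Matrix.mul_apply]
  refine Finset.sum_congr rfl fun a _ => ?_
  rw [mul_diagonal, Function.comp_apply, star_eq_conjTranspose,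
    conjTranspose_apply, IsHermitian.eigenvectorUnitary_apply,
    IsHermitian.eigenvectorUnitary_apply, mul_assoc, mul_left_comm]
  rfl

lemma isKrausFamily_choiKraus [Nonempty ι] (h : (choiState Φ).PosSemidef) :
    IsKrausFamily Φ (choiKraus h.1) := by
  have hd : (Fintype.card ι : ℂ) ≠ 0 := Nat.cast_ne_zero.mpr Fintype.card_ne_zero
  refine isKrausFamily_of_apply_single fun i j k l => ?_
  simp only [choiKraus_apply_mul_star h]
  rw [← Finset.mul_sum, ← apply_eq_sum_eigenvalues_mul, choiState_apply, mul_inv_cancel_left₀ hd]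

lemma krausWeight_choiKraus [Nonempty ι] (h : (choiState Φ).PosSemidef) :
    krausWeight (choiKraus h.1) = h.1.eigenvalues := by
  ext a
  have hd : (Fintype.card ι : ℝ) ≠ 0 := Nat.cast_ne_zero.mpr Fintype.card_ne_zero
  have hunit : ∑ x, h.1.eigenvectorBasis a x * star (h.1.eigenvectorBasis a x) = 1 := by
    have := EuclideanSpace.norm_sq_eq (h.1.eigenvectorBasis a)
    rw [h.1.eigenvectorBasis.norm_eq_one, one_pow] at this
    simp only [Complex.star_def, Complex.mul_conj']
    exact_mod_cast this.symm
  have htrace : (choiKraus h.1 a * (choiKraus h.1 a)ᴴ).trace =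
      Fintype.card ι * h.1.eigenvalues a := by
    simp only [Matrix.trace, diag, Matrix.mul_apply, conjTranspose_apply,
      choiKraus_apply_mul_star h]
    rw [← Fintype.sum_prod_type (fun x : ι × ι => (Fintype.card ι : ℂ) * (h.1.eigenvalues a *
      (h.1.eigenvectorBasis a x * star (h.1.eigenvectorBasis a x)))), ← Finset.mul_sum,
      ← Finset.mul_sum, hunit, mul_one]
  rw [krausWeight, htrace, ← Complex.ofReal_natCast, ← Complex.ofReal_mul, Complex.ofReal_re,
    mul_div_cancel_left₀ _ hd]

lemma vonNeumannEntropy_choiState [Nonempty ι] (h : (choiState Φ).PosSemidef) :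
    vonNeumannEntropy (choiState Φ) = shannonEntropy (krausWeight (choiKraus h.1)) := by
  rw [krausWeight_choiKraus h]
  exact dif_pos h.1

lemma varentropy_choiKraus_le [Nonempty ι] (h : (choiState Φ).PosSemidef)
    (hunital : IsUnital Φ) :
    varentropy (krausWeight (choiKraus h.1)) ≤ (choiState Φ).rank * (4 / Real.log 2 ^ 2) := by
  rw [h.1.rank_eq_card_non_zero_eigs, ← krausWeight_choiKraus h]
  exact varentropy_le_card_support_mul
    ((isKrausFamily_choiKraus h).krausWeight_mem_stdSimplex hunital)

end Choi

section KroneckerPower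

variable {J m n R : Type*} [Fintype J] [CommSemiring R]

/-- The Kronecker product `⨂ s, M s` of a finite family of matrices. -/
def piKronecker (M : J → Matrix m n R) : Matrix (J → m) (J → n) R :=
  of fun a b => ∏ s, M s (a s) (b s)

lemma piKronecker_one [DecidableEq m] : piKronecker (1 : J → Matrix m m R) = 1 := by
  ext a b
  simp only [piKronecker, of_apply, Pi.one_apply, Matrix.one_apply, Finset.prod_ite_zero,
    Finset.prod_const_one, Finset.mem_univ, forall_const, funext_iff]

lemma piKronecker_single [DecidableEq m] [DecidableEq n] (i : J → m) (j : J → n) :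
    piKronecker (fun s => single (i s) (j s) (1 : R)) = single i j 1 := by
  ext a b
  simp only [piKronecker, of_apply, single_apply, Finset.prod_ite_zero, Finset.prod_const_one,
    Finset.mem_univ, forall_const, funext_iff, forall_and]

lemma conjTranspose_piKronecker [StarRing R] (M : J → Matrix m n R) :
    (piKronecker M)ᴴ = piKronecker fun s => (M s)ᴴ := by
  ext a b
  simp only [piKronecker, of_apply, conjTranspose_apply, star_prod]

variable [DecidableEq J]

lemma piKronecker_mul_piKronecker {l : Type*} [Fintype m] (M : J → Matrix l m R)
    (N : J → Matrix m n R) :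
    piKronecker M * piKronecker N = piKronecker fun s => M s * N s := by
  ext a b
  simp only [piKronecker, of_apply, Matrix.mul_apply, ← Finset.prod_mul_distrib]
  exact (Fintype.prod_sum fun s x => M s (a s) x * N s x (b s)).symm

lemma trace_piKronecker [Fintype m] (M : J → Matrix m m R) :
    (piKronecker M).trace = ∏ s, (M s).trace :=
  (Fintype.prod_sum fun s x => M s x x).symm

lemma piKronecker_sum {A : Type*} [Fintype A] (M : J → A → Matrix m n R) :
    piKronecker (fun s => ∑ a, M s a) = ∑ f : J → A, piKronecker fun s => M s (f s) := by
  ext a b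
  simp only [piKronecker, of_apply, Matrix.sum_apply]
  exact Fintype.prod_sum fun s x => M s x (a s) (b s)

end KroneckerPower

section TensorPower

variable {κ J : Type} [Fintype κ] [DecidableEq κ] [Fintype J] [DecidableEq J]
  {φ : Matrix κ κ ℂ →ₗ[ℂ] Matrix κ κ ℂ}

/-- The tensor power `φ^{⊗ J}` of a map `φ` of matrices over an arbitrary finite index set, in
the encoding of `tensorPower`. -/
def tensorPow (J : Type) [Fintype J] [DecidableEq J] (φ : Matrix κ κ ℂ →ₗ[ℂ] Matrix κ κ ℂ) :
    Matrix (J → κ) (J → κ) ℂ →ₗ[ℂ] Matrix (J → κ) (J → κ) ℂ where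
  toFun M := of fun a b => ∑ i, ∑ j, M i j * ∏ s, φ (single (i s) (j s) 1) (a s) (b s)
  map_add' M N := by
    ext a b
    simp only [Matrix.add_apply, of_apply, add_mul, Finset.sum_add_distrib]
  map_smul' c M := by
    ext a b
    simp only [Matrix.smul_apply, smul_eq_mul, RingHom.id_apply, of_apply, Finset.mul_sum,
      mul_assoc]

lemma tensorPow_piKronecker (φ : Matrix κ κ ℂ →ₗ[ℂ] Matrix κ κ ℂ) (M : J → Matrix κ κ ℂ) :
    tensorPow J φ (piKronecker M) = piKronecker fun s => φ (M s) := by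
  have hsingle : ∀ N : Matrix κ κ ℂ, φ N = ∑ i, ∑ j, N i j • φ (single i j 1) := by
    intro N
    conv_lhs => rw [matrix_eq_sum_single N]
    simp only [map_sum, ← map_smul, smul_single, smul_eq_mul, mul_one]
  ext a b
  simp only [tensorPow, LinearMap.coe_mk, AddHom.coe_mk, piKronecker, of_apply,
    ← Finset.prod_mul_distrib, hsingle (M _), Matrix.sum_apply, Matrix.smul_apply, smul_eq_mul]
  simp only [Fintype.prod_sum]

omit [Fintype κ] [DecidableEq κ] [DecidableEq J] in
lemma linearMap_ext_piKronecker [Finite κ] {E : Type*} [AddCommMonoid E] [Module ℂ E]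
    {S T : Matrix (J → κ) (J → κ) ℂ →ₗ[ℂ] E}
    (h : ∀ M : J → Matrix κ κ ℂ, S (piKronecker M) = T (piKronecker M)) : S = T := by
  classical
  have := Fintype.ofFinite κ
  exact Matrix.ext_linearMap ℂ fun i j => LinearMap.ext_ring <| by
    simpa only [piKronecker_single, LinearMap.comp_apply, singleLinearMap_apply] using
      h fun s => single (i s) (j s) 1

lemma isUnital_tensorPow (hφ : IsUnital φ) : IsUnital (tensorPow J φ) := by
  rw [IsUnital, ← piKronecker_one, tensorPow_piKronecker]
  exact congrArg piKronecker (funext fun _ => hφ)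

lemma trace_tensorPow (hφ : ∀ X, (φ X).trace = X.trace) (X : Matrix (J → κ) (J → κ) ℂ) :
    (tensorPow J φ X).trace = X.trace := by
  have htrace : traceLinearMap (J → κ) ℂ ℂ ∘ₗ tensorPow J φ = traceLinearMap (J → κ) ℂ ℂ :=
    linearMap_ext_piKronecker fun M => by
      simp only [LinearMap.comp_apply, traceLinearMap_apply, tensorPow_piKronecker,
        trace_piKronecker, hφ]
  exact LinearMap.congr_fun htrace X

lemma isKrausFamily_tensorPow {A : Type*} [Fintype A] {K : A → Matrix κ κ ℂ}
    (h : IsKrausFamily φ K) :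
    IsKrausFamily (tensorPow J φ) fun f : J → A => piKronecker fun s => K (f s) :=
  isKrausFamily_iff_eq_sum.mpr <| linearMap_ext_piKronecker fun M => by
    simp only [tensorPow_piKronecker, h (M _), piKronecker_sum, LinearMap.sum_apply,
      LinearMap.comp_apply, LinearMap.mulLeft_apply, LinearMap.mulRight_apply,
      conjTranspose_piKronecker, piKronecker_mul_piKronecker]

omit [DecidableEq κ] in
lemma krausWeight_piKronecker [Nonempty κ] {A : Type*} (K : A → Matrix κ κ ℂ) :
    krausWeight (fun f : J → A => piKronecker fun s => K (f s)) =
      prodWeight J (krausWeight K) := by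
  ext f
  have htrace : ((piKronecker fun s => K (f s)) * (piKronecker fun s => K (f s))ᴴ).trace =
      ((∏ s, (Fintype.card κ * krausWeight K (f s)) : ℝ) : ℂ) := by
    simp only [conjTranspose_piKronecker, piKronecker_mul_piKronecker, trace_piKronecker,
      trace_mul_conjTranspose_eq_card_mul_krausWeight]
    push_cast
    rfl
  have hd : (Fintype.card κ : ℝ) ^ Fintype.card J ≠ 0 :=
    pow_ne_zero _ (Nat.cast_ne_zero.mpr Fintype.card_ne_zero)
  rw [krausWeight, htrace, Complex.ofReal_re, Finset.prod_mul_distrib, Finset.prod_const,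
    Finset.card_univ, Fintype.card_fun, Nat.cast_pow, mul_div_cancel_left₀ _ hd, prodWeight]

end TensorPower

section Depth

variable {ι κ : Type} [Fintype ι] [DecidableEq ι] [Nonempty ι] [Fintype κ] [DecidableEq κ]
  [Nonempty κ] {A : Type*} [Fintype A] {D : ℕ}

lemma one_sub_sub_rpow_mul_add_le_averageContraction {Φ : Matrix ι ι ℂ →ₗ[ℂ] Matrix ι ι ℂ}
    {K : A → Matrix ι ι ℂ} (hK : IsKrausFamily Φ K) (hΦ : IsPositiveTracePreserving Φ)
    (hunital : IsUnital Φ) {ν₁ ν₂ : Measure (EuclideanSpace ℂ ι)} [IsProbabilityMeasure ν₁]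
    {μ : Fin D → Measure (unitaryGroup ι ℂ)} (hν₁ : ∀ᵐ ψ ∂ν₁, ‖ψ‖ = 1)
    (hν₂ : IsStateDesign 1 ν₂) (hμ : ∀ k, IsUnitaryDesign 1 (μ k)) {ε δ : ℝ} (hδ : 0 < δ)
    (hD : 0 < D) (hV : varentropy (krausWeight K) ≤ D * (ε * δ ^ 2)) :
    1 - ε - 2 ^ (D * (shannonEntropy (krausWeight K) + δ) - Real.logb 2 (Fintype.card ι)) ≤
      averageContraction Φ D ν₁ ν₂ μ := by
  have hD' : (0 : ℝ) < D := Nat.cast_pos.mpr hD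
  refine le_trans ?_
    (one_sub_sub_rpow_le_averageContraction hK hΦ hunital hν₁ hν₂ hμ (mul_pos hD' hδ))
  have htail : D * varentropy (krausWeight K) / (D * δ) ^ 2 ≤ ε := by
    rw [div_le_iff₀ (by positivity)]
    calc D * varentropy (krausWeight K) ≤ D * (D * (ε * δ ^ 2)) := by gcongr
      _ = ε * (D * δ) ^ 2 := by ring
  rw [mul_add]
  gcongr

variable {φ : Matrix κ κ ℂ →ₗ[ℂ] Matrix κ κ ℂ} {K : A → Matrix κ κ ℂ}

lemma one_sub_sub_rpow_le_averageContraction_tensorPow {n : ℕ} (hK : IsKrausFamily φ K)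
    (htrace : ∀ X, (φ X).trace = X.trace) (hunital : IsUnital φ)
    {ν₁ ν₂ : Measure (EuclideanSpace ℂ (Fin n → κ))} [IsProbabilityMeasure ν₁]
    {μ : Fin D → Measure (unitaryGroup (Fin n → κ) ℂ)} (hν₁ : ∀ᵐ ψ ∂ν₁, ‖ψ‖ = 1)
    (hν₂ : IsStateDesign 1 ν₂) (hμ : ∀ k, IsUnitaryDesign 1 (μ k)) (hn : 0 < n) {δ : ℝ}
    (hδ : 0 < δ) :
    1 - D * varentropy (krausWeight K) / δ ^ 2 * (n : ℝ)⁻¹ -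
        (2 ^ (D * shannonEntropy (krausWeight K) + δ - Real.logb 2 (Fintype.card κ))) ^ n ≤
      averageContraction (tensorPow (Fin n) φ) D ν₁ ν₂ μ := by
  have hn' : (0 : ℝ) < n := Nat.cast_pos.mpr hn
  have hpow := isKrausFamily_tensorPow (J := Fin n) hK
  have hsum := (hK.krausWeight_mem_stdSimplex hunital).2
  have hbound := one_sub_sub_rpow_le_averageContraction hpow
    (hpow.isPositiveTracePreserving (trace_tensorPow htrace)) (isUnital_tensorPow hunital)
    hν₁ hν₂ hμ (mul_pos hn' hδ)
  rw [krausWeight_piKronecker, varentropy_prodWeight hsum, shannonEntropy_prodWeight hsum,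
    Fintype.card_fun, Fintype.card_fin, Nat.cast_pow, Real.logb_pow] at hbound
  convert hbound using 2
  · field_simp
  · rw [← Real.rpow_natCast, ← Real.rpow_mul zero_le_two]
    ring_nf

lemma tendsto_averageContraction_tensorPow (hK : IsKrausFamily φ K)
    (htrace : ∀ X, (φ X).trace = X.trace) (hunital : IsUnital φ)
    (hD : D * shannonEntropy (krausWeight K) < Real.logb 2 (Fintype.card κ))
    {ν₁ ν₂ : (n : ℕ) → Measure (EuclideanSpace ℂ (Fin n → κ))}
    {μ : (n : ℕ) → Fin D → Measure (unitaryGroup (Fin n → κ) ℂ)}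
    [∀ n, IsProbabilityMeasure (ν₁ n)] (hν₁ : ∀ n, ∀ᵐ ψ ∂ν₁ n, ‖ψ‖ = 1)
    (hν₂ : ∀ n, IsStateDesign 1 (ν₂ n)) (hμ : ∀ n k, IsUnitaryDesign 1 (μ n k)) :
    Tendsto (fun n => averageContraction (tensorPow (Fin n) φ) D (ν₁ n) (ν₂ n) (μ n))
      atTop (𝓝 1) := by
  have := fun n => (hν₂ n).isProbabilityMeasure
  have := fun n k => (hμ n k).isProbabilityMeasure
  obtain ⟨δ, hδ, hgap⟩ := exists_between (sub_pos.mpr hD)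
  have htail : Tendsto (fun n : ℕ => D * varentropy (krausWeight K) / δ ^ 2 * (n : ℝ)⁻¹)
      atTop (𝓝 0) := by
    simpa only [mul_zero] using tendsto_inv_atTop_nhds_zero_nat.const_mul
      (D * varentropy (krausWeight K) / δ ^ 2)
  have hcard : Tendsto (fun n : ℕ => ((2 : ℝ) ^ (D * shannonEntropy (krausWeight K) + δ -
      Real.logb 2 (Fintype.card κ))) ^ n) atTop (𝓝 0) :=
    tendsto_pow_atTop_nhds_zero_of_lt_one (by positivity)
      (Real.rpow_lt_one_of_one_lt_of_neg one_lt_two (by linarith))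
  refine tendsto_of_tendsto_of_tendsto_of_le_of_le'
    (by simpa only [sub_zero] using (tendsto_const_nhds.sub htail).sub hcard)
    tendsto_const_nhds ?_ (Eventually.of_forall fun n => averageContraction_le_one
      ((isKrausFamily_tensorPow hK).isPositiveTracePreserving (trace_tensorPow htrace)))
  filter_upwards [eventually_gt_atTop 0] with n hn
  exact one_sub_sub_rpow_le_averageContraction_tensorPow hK htrace hunital (hν₁ n) (hν₂ n)
    (hμ n) hn hδ

end Depth

theorem mainTheorem4_general :
    (∀ ε δ : ℝ, 0 < ε → 0 < δ → ∀ K : ℕ, ∃ D₀ : ℕ,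
      ∀ (ι : Type) [Fintype ι] [DecidableEq ι] [Nonempty ι]
        (Φ : Matrix ι ι ℂ →ₗ[ℂ] Matrix ι ι ℂ),
        IsQuantumChannel Φ → IsUnital Φ → (choiState Φ).rank ≤ K →
        ∀ D : ℕ, D₀ ≤ D →
        ∀ (ν₁ ν₂ : Measure (EuclideanSpace ℂ ι)) (μ : Fin D → Measure (unitaryGroup ι ℂ)),
          IsProbabilityMeasure ν₁ → (∀ᵐ ψ ∂ν₁, ‖ψ‖ = 1) → IsStateDesign 1 ν₂ →
          (∀ k, IsUnitaryDesign 1 (μ k)) →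
          1 - ε - (2 : ℝ) ^ ((D : ℝ) * (vonNeumannEntropy (choiState Φ) + δ) -
              Real.logb 2 (Fintype.card ι)) ≤
            averageContraction Φ D ν₁ ν₂ μ) ∧
    (∀ (κ : Type) [Fintype κ] [DecidableEq κ] [Nonempty κ] (φ : Matrix κ κ ℂ →ₗ[ℂ] Matrix κ κ ℂ),
      IsQuantumChannel φ → IsUnital φ →
      ∀ D : ℕ, (D : ℝ) * vonNeumannEntropy (choiState φ) < Real.logb 2 (Fintype.card κ) →
      ∀ (ν₁ ν₂ : (n : ℕ) → Measure (EuclideanSpace ℂ (Fin n → κ)))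
        (μ : (n : ℕ) → Fin D → Measure (unitaryGroup (Fin n → κ) ℂ)),
        (∀ n, IsProbabilityMeasure (ν₁ n)) → (∀ n, ∀ᵐ ψ ∂ν₁ n, ‖ψ‖ = 1) →
        (∀ n, IsStateDesign 1 (ν₂ n)) → (∀ n k, IsUnitaryDesign 1 (μ n k)) →
        Tendsto (fun n => averageContraction (tensorPow (Fin n) φ) D (ν₁ n) (ν₂ n) (μ n))
          atTop (𝓝 1)) := by
  refine ⟨fun ε δ hε hδ K => ?_,
    fun κ _ _ _ φ hφ hunital D hD ν₁ ν₂ μ hprob hν₁ hν₂ hμ => ?_⟩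
  · obtain ⟨D₀, hD₀⟩ := exists_nat_gt (K * (4 / Real.log 2 ^ 2) / (ε * δ ^ 2))
    refine ⟨D₀ + 1, fun ι _ _ _ Φ hΦ hunital hrank D hD ν₁ ν₂ μ _ hν₁ hν₂ hμ => ?_⟩
    have hchoi := hΦ.posSemidef_choiState
    have hkraus := isKrausFamily_choiKraus hchoi
    rw [vonNeumannEntropy_choiState hchoi]
    refine one_sub_sub_rpow_mul_add_le_averageContraction hkraus
      (hkraus.isPositiveTracePreserving hΦ.tracePreserving) hunital hν₁ hν₂ hμ hδ (by omega) ?_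
    calc varentropy (krausWeight (choiKraus hchoi.1))
        ≤ (choiState Φ).rank * (4 / Real.log 2 ^ 2) := varentropy_choiKraus_le hchoi hunital
      _ ≤ K * (4 / Real.log 2 ^ 2) := by gcongr
      _ ≤ D₀ * (ε * δ ^ 2) := ((div_lt_iff₀ (by positivity)).mp hD₀).le
      _ ≤ D * (ε * δ ^ 2) := by gcongr; omega
  · have hchoi := hφ.posSemidef_choiState
    rw [vonNeumannEntropy_choiState hchoi] at hD
    exact tendsto_averageContraction_tensorPow (isKrausFamily_choiKraus hchoi)
      hφ.tracePreserving hunital hD hν₁ hν₂ hμ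

lemma logb_two_card_qubits (n : ℕ) : Real.logb 2 (Fintype.card (Qubits n)) = n := by
  rw [Fintype.card_fun, Fintype.card_fin, Fintype.card_fin, Nat.cast_pow, Real.logb_pow,
    Nat.cast_ofNat, Real.logb_self_eq_one one_lt_two, mul_one]

theorem mainTheorem4 :
    (∀ ε δ : ℝ, 0 < ε → ε < 1 → 0 < δ → ∀ K : ℕ, ∃ D₀ : ℕ,
      ∀ (n : ℕ) (Φ : Matrix (Qubits n) (Qubits n) ℂ →ₗ[ℂ] Matrix (Qubits n) (Qubits n) ℂ),
        IsQuantumChannel Φ → IsUnital Φ → (choiState Φ).rank ≤ K →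
        ∀ D : ℕ, D₀ ≤ D →
        ∀ (ν₁ ν₂ : Measure (EuclideanSpace ℂ (Qubits n)))
          (μ : Fin D → Measure (Matrix.unitaryGroup (Qubits n) ℂ)),
          IsStateDesign 1 ν₁ → IsStateDesign 1 ν₂ → (∀ k, IsUnitaryDesign 1 (μ k)) →
          1 - ε - (2 : ℝ) ^ ((D : ℝ) * (vonNeumannEntropy (choiState Φ) + δ) - (n : ℝ)) ≤
            averageContraction Φ D ν₁ ν₂ μ) ∧
    (∀ φ : Matrix (Fin 2) (Fin 2) ℂ →ₗ[ℂ] Matrix (Fin 2) (Fin 2) ℂ,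
      IsQuantumChannel φ → IsUnital φ →
      ∀ D : ℕ, (D : ℝ) * vonNeumannEntropy (choiState φ) < 1 →
      ∀ (ν₁ ν₂ : (n : ℕ) → Measure (EuclideanSpace ℂ (Qubits n)))
        (μ : (n : ℕ) → Fin D → Measure (Matrix.unitaryGroup (Qubits n) ℂ)),
        (∀ n, IsStateDesign 1 (ν₁ n)) → (∀ n, IsStateDesign 1 (ν₂ n)) →
        (∀ n k, IsUnitaryDesign 1 (μ n k)) →
        Tendsto (fun n => averageContraction (tensorPower φ n) D (ν₁ n) (ν₂ n) (μ n))
          atTop (𝓝 1)) := by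
  refine ⟨fun ε δ hε _ hδ K => ?_, fun φ hφ hunital D hD ν₁ ν₂ μ hν₁ hν₂ hμ =>
    mainTheorem4_general.2 (Fin 2) φ hφ hunital D (by simpa using hD) ν₁ ν₂ μ
      (fun n => (hν₁ n).isProbabilityMeasure) (fun n => (hν₁ n).ae_norm_eq_one) hν₂ hμ⟩
  obtain ⟨D₀, hD₀⟩ := mainTheorem4_general.1 ε δ hε hδ K
  refine ⟨D₀, fun n Φ hΦ hunital hrank D hD ν₁ ν₂ μ hν₁ hν₂ hμ => ?_⟩
  rw [← logb_two_card_qubits n]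
  exact hD₀ (Qubits n) Φ hΦ hunital hrank D hD ν₁ ν₂ μ hν₁.isProbabilityMeasure
    hν₁.ae_norm_eq_one hν₂ hμ
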